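/- **Theorem 1.** Setting. Let $X\in\mathbb R^{M\times N}$ be a fixed design matrix with columns $X_1,\dots,X_N$, let $L\in\mathbb N$, and let $\mathbb S_L=\{\gamma\subset\{1,\dots,N\}: 1\le|\gamma|\le L\}$. For $\gamma\in\mathbb S_L$ let $X_\gamma$ be the submatrix of columns indexed by $\gamma$, let $\mu_\gamma$ be the subvector of $\mu$ indexed by $\gamma$, and let $\Delta^{|\gamma|-1}$ be the probability simplex in $\mathbb R^{|\gamma|}$. For $y\in\mathbb R^M$ put $\hat\mu_\gamma=(X_\gamma^\top X_\gamma)^{-1}X_\gamma^\top y$ and $\mathrm{RSS}_\gamma=\|y-X_\gamma\hat\mu_\gamma\|_2^2$. With hyperparameters $\theta\in(0,1)$, $\kappa_1>0$, $\kappa_2\ge0$, the marginal posterior probability of $\gamma\in\mathbb S_L$ is $$p(\gamma\mid y)\ \propto\ p(\gamma)\int_0^\infty \phi^{(\kappa_1+|\gamma|-1)/2-1}e^{-\phi\kappa_2/2}\ \mathbb E_{\mu_\gamma\sim\mathrm{Dir}(1,\dots,1)}\Big[\phi^{M/2}e^{-\frac{\phi}{2}\|y-X_\gamma\mu_\gamma\|_2^2}\Big]\,d\phi,$$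 $$p(\gamma)\ \propto\ \Gamma(|\gamma|)^{-1}\big\{\mathsf 1^\top(X_\gamma^\top X_\gamma)^{-1}\mathsf 1\big\}^{1/2}\det(X_\gamma^\top X_\gamma)^{1/2}\,\theta^{|\gamma|}(1-\theta)^{N-|\gamma|}\,\mathbb 1_{\mathbb S_L}(\gamma),$$ where $\mathrm{Dir}(1,\dots,1)$ is the uniform distribution on $\Delta^{|\gamma|-1}$, the constants of proportionality do not depend on $\gamma$ (the kernel of the prior of $\phi$ given $\gamma$ is used as displayed), and $p(\cdot\mid y)$ is normalized to sum to one over $\mathbb S_L$. Assumptions, with constants $c_\theta>0$, $c_\mu\ge6$, $c_M\ge4$: (A1) $\|X_j\|_2^2=M$ for every $j$, and for some $\underline\lambda\in(0,1]$, $\lambda_{\min}(X_\gamma^\top X_\gamma)\ge M\underline\lambda$ for all $\gamma\in\mathbb S_L$. (A2) $\theta/(1-\theta)=N^{-c_\theta L}$. (A3) $0<\kappa_1\le M$ and $0\le\kappa_2\le\sigma^2M/2$. (A4) $y\sim\mathcal N(X_{\gamma^*}\mu^*_{\gamma^*},\sigma^2I_M)$ with $\sigma>0$, $\ell^*:=|\gamma^*|\le\min(L,\sqrt{L\log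 N})$, $\mu^*_{\gamma^*}\in\Delta^{\ell^*-1}$ and $\min_{j\in\gamma^*}|\mu^*_j|\ge \dfrac{c_\mu\sigma\sqrt{L\log N}}{\underline\lambda\sqrt M}$. (A5) $L\ge3$ and $M\ge c_M\,\ell^*L\log N$. Claim. There are universal constants $c_1,c_2>0$ (depending on none of the quantities above) such that, under (A1)–(A5), there is an event of probability at least $1-c_1N^{-c_2}$ on which $p(\gamma^*\mid y)>0$ and, simultaneously for all $\gamma\in\mathbb S_L$, $\kappa_2+\mathrm{RSS}_\gamma>0$ and $$\frac{p(\gamma\mid y)}{p(\gamma^*\mid y)}\ \le\ 3\left(\frac{\theta\sqrt{2\pi}}{1-\theta}\right)^{|\gamma|-\ell^*}\left(\frac{\kappa_2+\mathrm{RSS}_{\gamma^*}+\sigma^2\ell^*\log N}{\kappa_2+\mathrm{RSS}_\gamma}\right)^{(\kappa_1+M)/2}.$$ -/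

import Mathlib

open MeasureTheory ProbabilityTheory Set
open scoped Matrix ENNReal

noncomputable section

namespace BVSS

/-- The sparse model space: nonempty sets of at most `L` covariates among `N`. -/
def sparseModels (N L : ℕ) : Finset (Finset (Fin N)) :=
  Finset.univ.filter fun γ => 1 ≤ γ.card ∧ γ.card ≤ L

/-- The submatrix `X_γ` made of the columns of `X` with index in `γ`, in increasing order. -/
def subdesign {M N : ℕ} (X : Matrix (Fin M) (Fin N) ℝ) (γ : Finset (Fin N)) :
    Matrix (Fin M) (Fin γ.card) ℝ :=
  X.submatrix id (γ.orderEmbOfFin rfl)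

/-- The subvector `w_γ` made of the entries of `w` with index in `γ`, in increasing order. -/
def subvec {N : ℕ} (w : Fin N → ℝ) (γ : Finset (Fin N)) : Fin γ.card → ℝ :=
  fun i => w (γ.orderEmbOfFin rfl i)

/-- The Gram matrix `Zᵀ Z`. -/
def gram {M l : ℕ} (Z : Matrix (Fin M) (Fin l) ℝ) : Matrix (Fin l) (Fin l) ℝ := Zᵀ * Z

theorem gram_isHermitian {M l : ℕ} (Z : Matrix (Fin M) (Fin l) ℝ) : (gram Z).IsHermitian := by
  have h := Matrix.isHermitian_conjTranspose_mul_self Z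
  rwa [Matrix.conjTranspose_eq_transpose_of_trivial] at h

/-- The squared Euclidean norm. -/
def sqNorm {M : ℕ} (v : Fin M → ℝ) : ℝ := ∑ i, v i ^ 2

/-- The ordinary least squares estimator `(Zᵀ Z)⁻¹ Zᵀ y`. -/
def ols {M l : ℕ} (Z : Matrix (Fin M) (Fin l) ℝ) (y : Fin M → ℝ) : Fin l → ℝ :=
  (gram Z)⁻¹ *ᵥ (Zᵀ *ᵥ y)

/-- The unconstrained residual sum of squares of the regression of `y` on `Z`. -/
def rss {M l : ℕ} (Z : Matrix (Fin M) (Fin l) ℝ) (y : Fin M → ℝ) : ℝ :=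
  sqNorm (y - Z *ᵥ ols Z y)

/-- The solid simplex `{u ∈ ℝᵏ : uᵢ ≥ 0, ∑ uᵢ ≤ 1}`. -/
def solidSimplex (k : ℕ) : Set (Fin k → ℝ) := {u | (∀ i, 0 ≤ u i) ∧ ∑ i, u i ≤ 1}

/-- The Dirichlet distribution with parameter vector `(1, …, 1)` on the standard simplex of `ℝˡ`,
`l ≥ 1`: the first `l - 1` coordinates have Lebesgue density `Γ(l) = (l - 1)!` on the solid
simplex, and the last coordinate is one minus their sum. (The value at `l = 0` is irrelevant.) -/
def dirichletOnes : (l : ℕ) → Measure (Fin l → ℝ)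
  | 0 => 0
  | k + 1 =>
    ((ENNReal.ofReal (Real.Gamma ((k : ℝ) + 1))) • volume.restrict (solidSimplex k)).map
      (fun u => Fin.snoc (α := fun _ => ℝ) u (1 - ∑ i, u i))

/-- The prior weight of the model `γ`, up to a constant that does not depend on `γ`:
`Γ(|γ|)⁻¹ (1ᵀ (X_γᵀ X_γ)⁻¹ 1)^{1/2} det(X_γᵀ X_γ)^{1/2} θ^{|γ|} (1 - θ)^{N - |γ|}` on the sparse
model space, and `0` outside it. -/
def modelPrior {M N : ℕ} (X : Matrix (Fin M) (Fin N) ℝ) (L : ℕ) (θ : ℝ)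
    (γ : Finset (Fin N)) : ℝ :=
  if γ ∈ sparseModels N L then
    (Real.Gamma (γ.card : ℝ))⁻¹
      * √((1 : Fin γ.card → ℝ) ⬝ᵥ ((gram (subdesign X γ))⁻¹ *ᵥ 1))
      * √(gram (subdesign X γ)).det
      * θ ^ γ.card * (1 - θ) ^ (N - γ.card)
  else 0

/-- The prior kernel of the precision `φ` in a model of size `l`:
`φ^{(κ₁ + l - 1)/2 - 1} e^{-φ κ₂/2}`. -/
def precisionPrior (κ₁ κ₂ : ℝ) (l : ℕ) (φ : ℝ) : ℝ :=
  φ ^ ((κ₁ + (l : ℝ) - 1) / 2 - 1) * Real.exp (-φ * κ₂ / 2)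

/-- The likelihood kernel `φ^{M/2} exp(-(φ/2) ‖y - Z u‖²)`. -/
def likelihood {M l : ℕ} (Z : Matrix (Fin M) (Fin l) ℝ) (y : Fin M → ℝ)
    (u : Fin l → ℝ) (φ : ℝ) : ℝ :=
  φ ^ ((M : ℝ) / 2) * Real.exp (-(φ / 2) * sqNorm (y - Z *ᵥ u))

/-- The marginal likelihood of `(γ, φ)`: the likelihood averaged over `u ∼ Dir(1, …, 1)`. -/
def marginalLikelihood {M l : ℕ} (Z : Matrix (Fin M) (Fin l) ℝ) (y : Fin M → ℝ)
    (φ : ℝ) : ℝ≥0∞ :=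
  ∫⁻ u, ENNReal.ofReal (likelihood Z y u φ) ∂(dirichletOnes l)

/-- The unnormalized posterior mass of the model `γ`:
`p(γ) ∫₀^∞ p(φ ∣ γ) p(y ∣ γ, φ) dφ`. -/
def posteriorMass {M N : ℕ} (X : Matrix (Fin M) (Fin N) ℝ) (L : ℕ) (θ κ₁ κ₂ : ℝ)
    (y : Fin M → ℝ) (γ : Finset (Fin N)) : ℝ≥0∞ :=
  ENNReal.ofReal (modelPrior X L θ γ) *
    ∫⁻ φ in Ioi (0 : ℝ), ENNReal.ofReal (precisionPrior κ₁ κ₂ γ.card φ) *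
      marginalLikelihood (subdesign X γ) y φ

/-- The marginal posterior probability `p(γ ∣ y)`. -/
def modelPosterior {M N : ℕ} (X : Matrix (Fin M) (Fin N) ℝ) (L : ℕ) (θ κ₁ κ₂ : ℝ)
    (y : Fin M → ℝ) (γ : Finset (Fin N)) : ℝ :=
  (posteriorMass X L θ κ₁ κ₂ y γ /
    ∑ γ' ∈ sparseModels N L, posteriorMass X L θ κ₁ κ₂ y γ').toReal

/-- The normal distribution `N(m, σ² I)` on `ℝᴹ`, the law of independent coordinates
`N(mᵢ, σ²)`. -/
def isoGaussian {M : ℕ} (m : Fin M → ℝ) (σ : ℝ) : Measure (Fin M → ℝ) :=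
  Measure.pi fun i => gaussianReal (m i) (σ ^ 2).toNNReal

end BVSS

end

open BVSS

/-!
The marginal likelihood of a model is an integral over the simplex of a Gaussian function of the
coefficients. In the affine chart of the hyperplane `∑ uᵢ = 1` (`simplexChart`) the loss splits into
a residual sum of squares plus a positive definite quadratic form whose determinant is
`1ᵀ G⁻¹ 1 · det G`, with `G` the Gram matrix (`det_gram_chartDesign`). This is the factor in the
model prior, and so the prior cancels the Gaussian normalization, except for powers of `√(2π)` and
the size penalty in `θ`; the precision `φ` is then integrated by a Gamma integral whose exponent does
not depend on the model.

* Upper bound, for every model: extend the simplex to the whole hyperplane, and use that the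
  residual constrained to the hyperplane is at least the unconstrained one (`evidence_le`).
* Lower bound, for the true model (`le_evidence`): the residual constrained to the hyperplane exceeds
  the unconstrained one by at most the energy of the noise projected on the columns of the model. The
  beta-min condition puts the constrained least squares estimator deep inside the simplex, and
  Markov's inequality for the Gaussian, averaged over `φ`, shows that the simplex carries at least
  half of the mass of the hyperplane (`half_le_lintegral_of_ellipsoid_subset`). This half costs a
  factor `2 ≤ 3` in the ratio.

The lower bound needs the projected noise energy to be at most `σ² ℓ log N` and the total noise energy
to be at most `4 σ² M`. Both are quadratic forms in Gaussian noise, and the exponential moment of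
such a form is again a Gaussian integral, a power of a determinant
(`lintegral_exp_quadratic_isoGaussian`); a Chernoff bound then gives the probability of the event
(`one_sub_le_isoGaussian_noiseEvent`). Residuals are almost surely nonzero since every sparse model
has fewer than `M` columns.
-/

/-! ### Least squares and Gram matrices -/

section LeastSquares

variable {M l : ℕ}

theorem sqNorm_eq_dotProduct (v : Fin M → ℝ) : sqNorm v = v ⬝ᵥ v := by
  simp [sqNorm, dotProduct, sq]

theorem sqNorm_nonneg (v : Fin M → ℝ) : 0 ≤ sqNorm v :=
  Finset.sum_nonneg fun _ _ => sq_nonneg _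

theorem sqNorm_pos {v : Fin M → ℝ} (hv : v ≠ 0) : 0 < sqNorm v := by
  rw [sqNorm_eq_dotProduct]
  have := Matrix.dotProduct_star_self_pos_iff.2 hv
  simpa using this

theorem continuous_sqNorm : Continuous (sqNorm : (Fin M → ℝ) → ℝ) := by
  unfold sqNorm; fun_prop

theorem sq_apply_le_sqNorm (v : Fin M → ℝ) (i : Fin M) : v i ^ 2 ≤ sqNorm v :=
  Finset.single_le_sum (f := fun i => v i ^ 2) (fun _ _ => sq_nonneg _) (Finset.mem_univ i)

theorem sqNorm_mulVec (Z : Matrix (Fin M) (Fin l) ℝ) (u : Fin l → ℝ) :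
    sqNorm (Z *ᵥ u) = u ⬝ᵥ (gram Z *ᵥ u) := by
  rw [sqNorm_eq_dotProduct, gram, ← Matrix.mulVec_mulVec, Matrix.dotProduct_mulVec u,
    Matrix.vecMul_transpose]

theorem sqNorm_add (v w : Fin M → ℝ) : sqNorm (v + w) = sqNorm v + 2 * (v ⬝ᵥ w) + sqNorm w := by
  simp only [sqNorm_eq_dotProduct, add_dotProduct, dotProduct_add, dotProduct_comm w v]
  ring

/-- Normal equations: the residual is orthogonal to the columns of `Z`. -/
theorem transpose_mulVec_residual {Z : Matrix (Fin M) (Fin l) ℝ} (hZ : (gram Z).PosDef)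
    (y : Fin M → ℝ) : Zᵀ *ᵥ (y - Z *ᵥ ols Z y) = 0 := by
  have hu : IsUnit (gram Z).det := hZ.det_pos.ne'.isUnit
  rw [Matrix.mulVec_sub, Matrix.mulVec_mulVec, ols, Matrix.mulVec_mulVec]
  change _ - (gram Z * (gram Z)⁻¹) *ᵥ _ = 0
  rw [Matrix.mul_nonsing_inv _ hu, Matrix.one_mulVec, sub_self]

/-- Pythagoras: the quadratic loss splits into the residual sum of squares and the loss relative
to the least squares estimator. -/
theorem sqNorm_sub_mulVec {Z : Matrix (Fin M) (Fin l) ℝ} (hZ : (gram Z).PosDef)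
    (y : Fin M → ℝ) (u : Fin l → ℝ) :
    sqNorm (y - Z *ᵥ u) = rss Z y + sqNorm (Z *ᵥ (u - ols Z y)) := by
  have h : y - Z *ᵥ u = (y - Z *ᵥ ols Z y) + Z *ᵥ (ols Z y - u) := by
    rw [Matrix.mulVec_sub]; abel
  have h0 : (y - Z *ᵥ ols Z y) ⬝ᵥ (Z *ᵥ (ols Z y - u)) = 0 := by
    rw [Matrix.dotProduct_mulVec, ← Matrix.mulVec_transpose, transpose_mulVec_residual hZ,
      zero_dotProduct]
  have h1 : Z *ᵥ (ols Z y - u) = -(Z *ᵥ (u - ols Z y)) := by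
    rw [← Matrix.mulVec_neg, neg_sub]
  rw [h, sqNorm_add, h0, h1]
  simp [rss, sqNorm]

theorem rss_le {Z : Matrix (Fin M) (Fin l) ℝ} (hZ : (gram Z).PosDef)
    (y : Fin M → ℝ) (u : Fin l → ℝ) : rss Z y ≤ sqNorm (y - Z *ᵥ u) := by
  rw [sqNorm_sub_mulVec hZ]
  linarith [sqNorm_nonneg (Z *ᵥ (u - ols Z y))]

theorem rss_nonneg (Z : Matrix (Fin M) (Fin l) ℝ) (y : Fin M → ℝ) : 0 ≤ rss Z y :=
  sqNorm_nonneg _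

theorem continuous_ols (Z : Matrix (Fin M) (Fin l) ℝ) : Continuous (ols Z) := by
  unfold ols
  exact Continuous.matrix_mulVec continuous_const
    (Continuous.matrix_mulVec continuous_const continuous_id)

theorem continuous_fit (Z : Matrix (Fin M) (Fin l) ℝ) :
    Continuous fun y => Z *ᵥ ols Z y :=
  Continuous.matrix_mulVec continuous_const (continuous_ols Z)

theorem continuous_rss (Z : Matrix (Fin M) (Fin l) ℝ) : Continuous (rss Z) :=
  continuous_sqNorm.comp (continuous_id.sub (continuous_fit Z))

/-- The residual sum of squares of a noisy response is the noise energy minus the energy of the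
noise projected on the column space. -/
theorem rss_add_sqNorm_fit {Z : Matrix (Fin M) (Fin l) ℝ} (hZ : (gram Z).PosDef)
    (y : Fin M → ℝ) (u : Fin l → ℝ) :
    rss Z y + sqNorm (Z *ᵥ ols Z (y - Z *ᵥ u)) = sqNorm (y - Z *ᵥ u) := by
  have hu : IsUnit (gram Z).det := hZ.det_pos.ne'.isUnit
  have h : ols Z (y - Z *ᵥ u) = -(u - ols Z y) := by
    unfold ols
    rw [Matrix.mulVec_sub, Matrix.mulVec_sub, Matrix.mulVec_mulVec u, Matrix.mulVec_mulVec u]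
    change _ - ((gram Z)⁻¹ * gram Z) *ᵥ u = _
    rw [Matrix.nonsing_inv_mul _ hu, Matrix.one_mulVec, neg_sub]
  rw [sqNorm_sub_mulVec hZ, h, Matrix.mulVec_neg]
  simp [sqNorm]

theorem mul_sqNorm_le_of_le_eigenvalues (Z : Matrix (Fin M) (Fin l) ℝ) {c : ℝ}
    (h : ∀ i, c ≤ (gram_isHermitian Z).eigenvalues i) (u : Fin l → ℝ) :
    c * sqNorm u ≤ sqNorm (Z *ᵥ u) := by
  have hH := gram_isHermitian Z
  have hB : (gram Z - c • (1 : Matrix (Fin l) (Fin l) ℝ)).IsHermitian := by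
    refine hH.sub ?_
    simp [Matrix.IsHermitian]
  have hps : (gram Z - c • (1 : Matrix (Fin l) (Fin l) ℝ)).PosSemidef := by
    rw [hB.posSemidef_iff_eigenvalues_nonneg]
    intro i
    have h1 := hB.eigenvalues_mem_spectrum_real i
    have h2 : hB.eigenvalues i + c ∈ spectrum ℝ (gram Z) := by
      rw [add_comm]
      have h3 := spectrum.add_mem_add_iff (s := c) |>.2 h1
      rwa [Algebra.algebraMap_eq_smul_one, add_sub_cancel, add_comm] at h3
    rw [hH.spectrum_real_eq_range_eigenvalues] at h2
    obtain ⟨j, hj⟩ := h2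
    have := h j
    simp only [Pi.zero_apply]
    linarith
  have := hps.dotProduct_mulVec_nonneg u
  simp only [star_trivial, Matrix.sub_mulVec, Matrix.smul_mulVec, Matrix.one_mulVec,
    dotProduct_sub, dotProduct_smul, smul_eq_mul] at this
  rw [sqNorm_mulVec, sqNorm_eq_dotProduct]
  linarith

theorem gram_posDef_of_le {Z : Matrix (Fin M) (Fin l) ℝ} {c : ℝ} (hc : 0 < c)
    (h : ∀ u, c * sqNorm u ≤ sqNorm (Z *ᵥ u)) : (gram Z).PosDef := by
  refine Matrix.PosDef.of_dotProduct_mulVec_pos (gram_isHermitian Z) fun {u} hu => ?_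
  rw [star_trivial, ← sqNorm_mulVec]
  exact (mul_pos hc (sqNorm_pos hu)).trans_le (h u)

/-- The hat matrix `Z (Zᵀ Z)⁻¹ Zᵀ`, the orthogonal projection on the column space of `Z`. -/
noncomputable def hatMatrix (Z : Matrix (Fin M) (Fin l) ℝ) : Matrix (Fin M) (Fin M) ℝ :=
  Z * ((gram Z)⁻¹ * Zᵀ)

theorem dotProduct_hatMatrix {Z : Matrix (Fin M) (Fin l) ℝ} (hZ : (gram Z).PosDef)
    (e : Fin M → ℝ) : e ⬝ᵥ (hatMatrix Z *ᵥ e) = sqNorm (Z *ᵥ ols Z e) := by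
  have hu : IsUnit (gram Z).det := hZ.det_pos.ne'.isUnit
  have h1 : hatMatrix Z *ᵥ e = Z *ᵥ ols Z e := by
    simp [hatMatrix, ols, Matrix.mulVec_mulVec]
  have h2 : (e - Z *ᵥ ols Z e) ⬝ᵥ (Z *ᵥ ols Z e) = 0 := by
    rw [Matrix.dotProduct_mulVec, ← Matrix.mulVec_transpose, transpose_mulVec_residual hZ,
      zero_dotProduct]
  rw [sub_dotProduct, sub_eq_zero] at h2
  rw [h1, h2, sqNorm_eq_dotProduct]

theorem hatMatrix_isHermitian (Z : Matrix (Fin M) (Fin l) ℝ) : (hatMatrix Z).IsHermitian := by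
  have h := (gram_isHermitian Z).inv
  rw [Matrix.IsHermitian, Matrix.conjTranspose_eq_transpose_of_trivial] at h ⊢
  rw [hatMatrix, Matrix.transpose_mul, Matrix.transpose_mul, Matrix.transpose_transpose, h,
    Matrix.mul_assoc]

theorem sqNorm_fit_le {Z : Matrix (Fin M) (Fin l) ℝ} (hZ : (gram Z).PosDef) (e : Fin M → ℝ) :
    sqNorm (Z *ᵥ ols Z e) ≤ sqNorm e := by
  have h := sqNorm_sub_mulVec hZ e 0
  have h1 : Z *ᵥ (0 - ols Z e) = -(Z *ᵥ ols Z e) := by rw [← Matrix.mulVec_neg, zero_sub]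
  rw [Matrix.mulVec_zero, sub_zero, h1] at h
  have h2 : sqNorm (-(Z *ᵥ ols Z e)) = sqNorm (Z *ᵥ ols Z e) := by simp [sqNorm]
  linarith [rss_nonneg Z e]

theorem one_sub_half_hatMatrix_posDef {Z : Matrix (Fin M) (Fin l) ℝ} (hZ : (gram Z).PosDef) :
    (1 - (1 / 2 : ℝ) • hatMatrix Z).PosDef := by
  refine Matrix.PosDef.of_dotProduct_mulVec_pos ?_ fun {x} hx => ?_
  · refine Matrix.isHermitian_one.sub ?_
    have := hatMatrix_isHermitian Z
    rw [Matrix.IsHermitian, Matrix.conjTranspose_smul, this.eq, star_trivial]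
  · rw [star_trivial, Matrix.sub_mulVec, Matrix.one_mulVec, Matrix.smul_mulVec, dotProduct_sub,
      dotProduct_smul, dotProduct_hatMatrix hZ, smul_eq_mul, ← sqNorm_eq_dotProduct]
    linarith [sqNorm_fit_le hZ x, sqNorm_pos hx]

/-- The hat matrix `P` is a projection of rank `l`, so `1 - P / 2` has `l` eigenvalues `1 / 2` and the
remaining ones are `1`. -/
theorem det_one_sub_half_hatMatrix {Z : Matrix (Fin M) (Fin l) ℝ} (hZ : (gram Z).PosDef) :
    (1 - (1 / 2 : ℝ) • hatMatrix Z).det = (1 / 2) ^ l := by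
  have hu : IsUnit (gram Z).det := hZ.det_pos.ne'.isUnit
  rw [hatMatrix, ← Matrix.mul_smul, Matrix.det_one_sub_mul_comm, Matrix.smul_mul,
    Matrix.mul_assoc]
  change (1 - (1 / 2 : ℝ) • ((gram Z)⁻¹ * gram Z)).det = _
  rw [Matrix.nonsing_inv_mul _ hu]
  have : (1 : Matrix (Fin l) (Fin l) ℝ) - (1 / 2 : ℝ) • 1 = (1 / 2 : ℝ) • 1 := by
    ext i j; simp [Matrix.sub_apply]; ring
  rw [this, Matrix.det_smul, Matrix.det_one]
  simp

end LeastSquares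

/-! ### The affine chart of the simplex -/

section Chart

variable {M k : ℕ}

/-- The chart of the affine hyperplane `∑ uᵢ = 1` by its first `k` coordinates. -/
noncomputable def simplexChart (v : Fin k → ℝ) : Fin (k + 1) → ℝ :=
  Fin.snoc (α := fun _ => ℝ) v (1 - ∑ i, v i)

/-- The linear part of the chart `simplexChart`. -/
noncomputable def chartMatrix (k : ℕ) : Matrix (Fin (k + 1)) (Fin k) ℝ :=
  Matrix.of fun i j =>
    Fin.lastCases (motive := fun _ => ℝ) (-1) (fun i => (1 : Matrix (Fin k) (Fin k) ℝ) i j) i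

theorem chartMatrix_castSucc (i j : Fin k) :
    chartMatrix k i.castSucc j = (1 : Matrix (Fin k) (Fin k) ℝ) i j := by
  simp [chartMatrix]

theorem chartMatrix_last (j : Fin k) : chartMatrix k (Fin.last k) j = -1 := by
  simp [chartMatrix]

theorem chartMatrix_mulVec_castSucc (v : Fin k → ℝ) (i : Fin k) :
    (chartMatrix k *ᵥ v) i.castSucc = v i := by
  simp [chartMatrix_castSucc, Matrix.mulVec, dotProduct, Matrix.one_apply]

theorem chartMatrix_mulVec_last (v : Fin k → ℝ) :
    (chartMatrix k *ᵥ v) (Fin.last k) = -∑ i, v i := by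
  simp [chartMatrix_last, Matrix.mulVec, dotProduct]

theorem simplexChart_eq (v : Fin k → ℝ) :
    simplexChart v = Pi.single (Fin.last k) 1 + chartMatrix k *ᵥ v := by
  ext i
  refine Fin.lastCases ?_ (fun i => ?_) i
  · simp [simplexChart, chartMatrix_mulVec_last]; ring
  · simp [simplexChart, chartMatrix_mulVec_castSucc, Fin.castSucc_ne_last]

/-- The design matrix in the coordinates of the chart: the columns minus the last column. -/
noncomputable def chartDesign (Z : Matrix (Fin M) (Fin (k + 1)) ℝ) : Matrix (Fin M) (Fin k) ℝ :=
  Z * chartMatrix k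

/-- The response in the coordinates of the chart: the last column is subtracted. -/
noncomputable def chartResponse (Z : Matrix (Fin M) (Fin (k + 1)) ℝ) (y : Fin M → ℝ) : Fin M → ℝ :=
  y - Z *ᵥ Pi.single (Fin.last k) 1

theorem sub_mulVec_simplexChart (Z : Matrix (Fin M) (Fin (k + 1)) ℝ) (y : Fin M → ℝ)
    (v : Fin k → ℝ) :
    y - Z *ᵥ simplexChart v = chartResponse Z y - chartDesign Z *ᵥ v := by
  rw [simplexChart_eq, Matrix.mulVec_add, chartResponse, chartDesign, Matrix.mulVec_mulVec]
  abel

theorem chartDesign_mulVec_sub (Z : Matrix (Fin M) (Fin (k + 1)) ℝ) (v w : Fin k → ℝ) :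
    chartDesign Z *ᵥ (v - w) = Z *ᵥ (simplexChart v - simplexChart w) := by
  rw [simplexChart_eq, simplexChart_eq, add_sub_add_left_eq_sub, ← Matrix.mulVec_sub,
    Matrix.mulVec_mulVec, chartDesign]

theorem gram_chartDesign (Z : Matrix (Fin M) (Fin (k + 1)) ℝ) :
    gram (chartDesign Z) = (chartMatrix k)ᵀ * gram Z * chartMatrix k := by
  simp only [gram, chartDesign, Matrix.transpose_mul, Matrix.mul_assoc]

theorem gram_chartDesign_posDef {Z : Matrix (Fin M) (Fin (k + 1)) ℝ} (hZ : (gram Z).PosDef) :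
    (gram (chartDesign Z)).PosDef := by
  rw [gram_chartDesign, ← Matrix.conjTranspose_eq_transpose_of_trivial]
  refine hZ.conjTranspose_mul_mul_same fun v w h => ?_
  ext i
  have := congrFun h i.castSucc
  rwa [chartMatrix_mulVec_castSucc, chartMatrix_mulVec_castSucc] at this

/-- The determinant of the Gram matrix restricted to the hyperplane `∑ uᵢ = 0`. With `S` the
unimodular matrix whose first columns span the hyperplane and whose last column is the last basis
vector, this is the minor of `Sᵀ G S` at its last diagonal entry, and the last row of `S⁻¹` is
`1ᵀ`. -/
theorem det_gram_chartDesign {Z : Matrix (Fin M) (Fin (k + 1)) ℝ} (hZ : (gram Z).PosDef) :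
    (gram (chartDesign Z)).det =
      ((1 : Fin (k + 1) → ℝ) ⬝ᵥ ((gram Z)⁻¹ *ᵥ 1)) * (gram Z).det := by
  set S : Matrix (Fin (k + 1)) (Fin (k + 1)) ℝ :=
    Matrix.of fun i j => Fin.lastCases (motive := fun _ => ℝ)
      ((Pi.single (Fin.last k) 1 : Fin (k + 1) → ℝ) i) (fun j => chartMatrix k i j) j with hS
  have hScast : ∀ i (j : Fin k), S i j.castSucc = chartMatrix k i j := fun i j => by simp [hS]
  have hSlast : ∀ i, S i (Fin.last k) = (Pi.single (Fin.last k) 1 : Fin (k + 1) → ℝ) i :=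
    fun i => by simp [hS]
  -- `1ᵀ S` is the last row of the identity
  have hone : Sᵀ *ᵥ (1 : Fin (k + 1) → ℝ) = Pi.single (Fin.last k) 1 := by
    ext j
    refine Fin.lastCases ?_ (fun j => ?_) j
    · simp [Matrix.mulVec, dotProduct, hSlast]
    · simp [Matrix.mulVec, dotProduct, hScast, Fin.sum_univ_castSucc, chartMatrix_castSucc,
        chartMatrix_last, Matrix.one_apply, Fin.castSucc_ne_last]
  have hdet : S.det = 1 := by
    rw [Matrix.det_of_isLowerTriangular]
    · rw [Fin.prod_univ_castSucc]
      simp [hSlast, hScast, chartMatrix_castSucc]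
    · intro i j hij
      have hij' : i < j := by simpa using hij
      induction j using Fin.lastCases with
      | last => rw [hSlast, Pi.single_eq_of_ne hij'.ne]
      | cast j =>
        induction i using Fin.lastCases with
        | last => exact absurd hij' (by simp [Fin.le_last])
        | cast i =>
          have : i ≠ j := by rintro rfl; exact lt_irrefl _ hij'
          simp [hScast, chartMatrix_castSucc, this]
  have hSu : IsUnit S.det := by simp [hdet]
  have hSu' : IsUnit Sᵀ.det := by simp [Matrix.det_transpose, hdet]
  have hGu : IsUnit (gram Z).det := hZ.det_pos.ne'.isUnit
  set T := Sᵀ * gram Z * S with hT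
  have hTdet : T.det = (gram Z).det := by
    simp [hT, Matrix.det_mul, Matrix.det_transpose, hdet]
  have hminor : T.submatrix (Fin.last k).succAbove (Fin.last k).succAbove
      = gram (chartDesign Z) := by
    rw [gram_chartDesign]
    ext i j
    simp [hT, Matrix.mul_apply, hScast, Fin.succAbove_last]
  have h1 : T⁻¹ (Fin.last k) (Fin.last k) * (gram Z).det = (gram (chartDesign Z)).det := by
    rw [Matrix.inv_def, Matrix.smul_apply, Matrix.adjugate_fin_succ_eq_det_submatrix, hminor,
      hTdet, Ring.inverse_eq_inv', smul_eq_mul]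
    have := hZ.det_pos.ne'
    have he : (-1 : ℝ) ^ ((Fin.last k : ℕ) + (Fin.last k : ℕ)) = 1 := by
      rw [← two_mul, pow_mul]; simp
    rw [he]
    field_simp
  have h2 : T⁻¹ (Fin.last k) (Fin.last k) = (1 : Fin (k + 1) → ℝ) ⬝ᵥ ((gram Z)⁻¹ *ᵥ 1) := by
    have hTi : T⁻¹ = S⁻¹ * (gram Z)⁻¹ * Sᵀ⁻¹ := by
      rw [hT, Matrix.mul_inv_rev, Matrix.mul_inv_rev, Matrix.mul_assoc]
    have e1 : Sᵀ⁻¹ *ᵥ Pi.single (Fin.last k) 1 = 1 := by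
      rw [← hone, Matrix.mulVec_mulVec, Matrix.nonsing_inv_mul _ hSu', Matrix.one_mulVec]
    have e2 : Pi.single (Fin.last k) 1 ᵥ* S⁻¹ = 1 := by
      rw [← Matrix.mulVec_transpose, Matrix.transpose_nonsing_inv, e1]
    have e3 : T⁻¹ (Fin.last k) (Fin.last k)
        = Pi.single (Fin.last k) 1 ⬝ᵥ (T⁻¹ *ᵥ Pi.single (Fin.last k) 1) := by
      simp
    rw [e3, hTi, ← Matrix.mulVec_mulVec, e1, ← Matrix.mulVec_mulVec, Matrix.dotProduct_mulVec, e2]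
  rw [← h1, h2]

end Chart

/-! ### Gaussian and Gamma integrals -/

section GaussianIntegrals

/-- Tonelli's theorem for a product of functions of one coordinate each. -/
theorem lintegral_fin_prod_eq_prod {n : ℕ} (μ : Fin n → Measure ℝ) [∀ i, SigmaFinite (μ i)]
    {f : Fin n → ℝ → ℝ≥0∞} (hf : ∀ i, Measurable (f i)) :
    ∫⁻ x, ∏ i, f i (x i) ∂(Measure.pi μ) = ∏ i, ∫⁻ x, f i x ∂(μ i) := by
  induction n with
  | zero => simp
  | succ n ih =>
    have hmp := (measurePreserving_piFinSuccAbove μ 0).symm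
    rw [← hmp.lintegral_comp_emb (MeasurableEquiv.measurableEmbedding _)]
    simp_rw [MeasurableEquiv.piFinSuccAbove_symm_apply, Fin.insertNthEquiv,
      Fin.prod_univ_succ, Fin.insertNth_zero, Equiv.coe_fn_mk, Fin.cons_succ,
      Fin.zero_succAbove, cast_eq, Fin.cons_zero]
    have hm : Measurable fun x : Fin n → ℝ => ∏ i, f i.succ (x i) :=
      Finset.measurable_prod _ fun i _ => (hf i.succ).comp (measurable_pi_apply i)
    rw [← ih _ fun i => hf i.succ]
    exact lintegral_prod_mul (hf 0).aemeasurable hm.aemeasurable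

theorem lintegral_exp_neg_sq_half :
    ∫⁻ x : ℝ, ENNReal.ofReal (Real.exp (-(x ^ 2) / 2)) = ENNReal.ofReal √(2 * Real.pi) := by
  have h : ∀ x : ℝ, Real.exp (-(x ^ 2) / 2) = Real.exp (-(1 / 2) * x ^ 2) := fun x => by
    congr 1; ring
  simp_rw [h]
  rw [← ofReal_integral_eq_lintegral_ofReal (integrable_exp_neg_mul_sq (by norm_num))
    (Filter.Eventually.of_forall fun x => (Real.exp_pos _).le), integral_gaussian]
  congr 2
  ring

/-- The Gaussian integral of a positive definite quadratic form. -/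
theorem lintegral_exp_neg_half_quadratic {n : ℕ} {A : Matrix (Fin n) (Fin n) ℝ}
    (hA : A.PosDef) :
    ∫⁻ x : Fin n → ℝ, ENNReal.ofReal (Real.exp (-(x ⬝ᵥ (A *ᵥ x)) / 2))
      = ENNReal.ofReal (√(2 * Real.pi) ^ n / √A.det) := by
  open scoped MatrixOrder in
  obtain ⟨B, rfl⟩ := CStarAlgebra.nonneg_iff_eq_star_mul_self.mp hA.posSemidef.nonneg
  have hd := hA.det_pos
  simp only [Matrix.star_eq_conjTranspose, Matrix.conjTranspose_eq_transpose_of_trivial] at hd ⊢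
  rw [Matrix.det_mul, Matrix.det_transpose] at hd ⊢
  have hB : B.det ≠ 0 := fun h => by simp [h] at hd
  have hq : ∀ x : Fin n → ℝ, x ⬝ᵥ ((Bᵀ * B) *ᵥ x) = ∑ i, (B *ᵥ x) i ^ 2 := fun x => by
    rw [← Matrix.mulVec_mulVec, Matrix.dotProduct_mulVec, Matrix.vecMul_transpose]
    simp [dotProduct, sq]
  have hmeas : Measurable fun x : Fin n → ℝ =>
      ENNReal.ofReal (Real.exp (-(∑ i, x i ^ 2) / 2)) := by fun_prop
  have hlin : Measurable (Matrix.toLin' B) :=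
    (LinearMap.continuous_of_finiteDimensional _).measurable
  have h1 : ∫⁻ x : Fin n → ℝ, ENNReal.ofReal (Real.exp (-(x ⬝ᵥ ((Bᵀ * B) *ᵥ x)) / 2))
      = ENNReal.ofReal |B.det⁻¹| *
        ∫⁻ x : Fin n → ℝ, ENNReal.ofReal (Real.exp (-(∑ i, x i ^ 2) / 2)) := by
    simp_rw [hq]
    rw [← smul_eq_mul, ← lintegral_smul_measure, ← Real.map_matrix_volume_pi_eq_smul_volume_pi hB,
      lintegral_map hmeas hlin]
    simp [Matrix.toLin'_apply]
  have h2 : ∫⁻ x : Fin n → ℝ, ENNReal.ofReal (Real.exp (-(∑ i, x i ^ 2) / 2))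
      = ENNReal.ofReal (√(2 * Real.pi) ^ n) := by
    have : ∀ x : Fin n → ℝ, ENNReal.ofReal (Real.exp (-(∑ i, x i ^ 2) / 2))
        = ∏ i, ENNReal.ofReal (Real.exp (-(x i ^ 2) / 2)) := fun x => by
      rw [← ENNReal.ofReal_prod_of_nonneg fun i _ => (Real.exp_pos _).le, ← Real.exp_sum,
        ← Finset.sum_div, Finset.sum_neg_distrib]
    simp_rw [this]
    rw [volume_pi, lintegral_fin_prod_eq_prod (fun _ => volume)
      (f := fun _ t => ENNReal.ofReal (Real.exp (-(t ^ 2) / 2))) (fun i => by fun_prop),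
      lintegral_exp_neg_sq_half]
    simp [ENNReal.ofReal_pow]
  rw [h1, h2, ← ENNReal.ofReal_mul (abs_nonneg _), Real.sqrt_mul_self_eq_abs, abs_inv]
  congr 1
  ring

theorem lintegral_exp_neg_quadratic {n : ℕ} {A : Matrix (Fin n) (Fin n) ℝ}
    (hA : A.PosDef) {c : ℝ} (hc : 0 < c) :
    ∫⁻ x : Fin n → ℝ, ENNReal.ofReal (Real.exp (-(c / 2) * (x ⬝ᵥ (A *ᵥ x))))
      = ENNReal.ofReal (√(2 * Real.pi) ^ n / (√c ^ n * √A.det)) := by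
  have h := lintegral_exp_neg_half_quadratic (hA.smul hc)
  rw [Matrix.det_smul, Fintype.card_fin, Real.sqrt_mul (pow_nonneg hc.le n) A.det] at h
  have hs : √(c ^ n) = √c ^ n := by
    rw [Real.sqrt_eq_iff_mul_self_eq (by positivity) (by positivity), ← mul_pow,
      Real.mul_self_sqrt hc.le]
  rw [hs] at h
  rw [← h]
  refine lintegral_congr fun x => ?_
  rw [Matrix.smul_mulVec, dotProduct_smul, smul_eq_mul]
  congr 2
  ring

theorem lintegral_rpow_mul_exp_neg_mul {a b : ℝ} (ha : 0 < a) (hb : 0 < b) :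
    ∫⁻ x in Ioi (0 : ℝ), ENNReal.ofReal (x ^ (a - 1) * Real.exp (-(x / 2) * b))
      = ENNReal.ofReal (Real.Gamma a * (2 / b) ^ a) := by
  have hb2 : 0 < b / 2 := by positivity
  have h : ∀ x : ℝ, x ^ (a - 1) * Real.exp (-(x / 2) * b)
      = x ^ (a - 1) * Real.exp (-(b / 2 * x)) := fun x => by congr 2; ring
  simp_rw [h]
  rw [← ofReal_integral_eq_lintegral_ofReal, Real.integral_rpow_mul_exp_neg_mul_Ioi ha hb2]
  · rw [one_div_div, mul_comm]
  · have := Real.GammaIntegral_convergent ha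
    have h3 := Real.integral_rpow_mul_exp_neg_mul_Ioi ha hb2
    by_contra hcon
    have h4 := integral_undef hcon
    have : 0 < (1 / (b / 2)) ^ a * Real.Gamma a := by
      have := Real.Gamma_pos_of_pos ha
      positivity
    linarith
  · filter_upwards [self_mem_ae_restrict measurableSet_Ioi] with x hx
    have : (0 : ℝ) < x := hx
    simp only [Pi.zero_apply]
    positivity

end GaussianIntegrals

/-! ### Gaussian noise -/

section Noise

variable {M : ℕ}

theorem isoGaussian_eq_withDensity (m : Fin M → ℝ) {σ : ℝ} (hσ : 0 < σ) :
    isoGaussian m σ = (volume : Measure (Fin M → ℝ)).withDensity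
      fun y => ∏ i, gaussianPDF (m i) (σ ^ 2).toNNReal (y i) := by
  have hv : (σ ^ 2).toNNReal ≠ 0 := by simpa using hσ.ne'
  refine Measure.pi_eq fun s hs => ?_
  rw [withDensity_apply _ (MeasurableSet.univ_pi hs), volume_pi, Measure.restrict_pi_pi,
    lintegral_fin_prod_eq_prod _ fun i => measurable_gaussianPDF _ _]
  refine Finset.prod_congr rfl fun i _ => ?_
  rw [gaussianReal_of_var_ne_zero _ hv, withDensity_apply _ (hs i)]

theorem isoGaussian_absolutelyContinuous (m : Fin M → ℝ) {σ : ℝ} (hσ : 0 < σ) :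
    isoGaussian m σ ≪ volume := by
  rw [isoGaussian_eq_withDensity m hσ]
  exact withDensity_absolutelyContinuous _ _

instance isProbabilityMeasure_isoGaussian (m : Fin M → ℝ) (σ : ℝ) :
    IsProbabilityMeasure (isoGaussian m σ) := by
  unfold isoGaussian; infer_instance

/-- The exponential moment of a quadratic form `B` in Gaussian noise. -/
theorem lintegral_exp_quadratic_isoGaussian {B : Matrix (Fin M) (Fin M) ℝ}
    (hB : (1 - (1 / 2 : ℝ) • B).PosDef) (m : Fin M → ℝ) {σ : ℝ} (hσ : 0 < σ) :
    ∫⁻ y, ENNReal.ofReal (Real.exp ((y - m) ⬝ᵥ (B *ᵥ (y - m)) / (4 * σ ^ 2))) ∂isoGaussian m σ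
      = ENNReal.ofReal (1 / √(1 - (1 / 2 : ℝ) • B).det) := by
  have hmB : Measurable fun y : Fin M → ℝ =>
      ENNReal.ofReal (Real.exp ((y - m) ⬝ᵥ (B *ᵥ (y - m)) / (4 * σ ^ 2))) := by
    have : Continuous fun y : Fin M → ℝ => (y - m) ⬝ᵥ (B *ᵥ (y - m)) := by
      refine Continuous.dotProduct (by fun_prop) (Continuous.matrix_mulVec (by fun_prop)
        (by fun_prop))
    exact ENNReal.measurable_ofReal.comp
      (Real.measurable_exp.comp (this.measurable.div_const _))
  have hmD : Measurable fun y : Fin M → ℝ => ∏ i, gaussianPDF (m i) (σ ^ 2).toNNReal (y i) :=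
    Finset.measurable_prod _ fun i _ => (measurable_gaussianPDF _ _).comp (measurable_pi_apply i)
  rw [isoGaussian_eq_withDensity m hσ, lintegral_withDensity_eq_lintegral_mul _ hmD hmB]
  have hv : ((σ ^ 2).toNNReal : ℝ) = σ ^ 2 := Real.coe_toNNReal _ (sq_nonneg σ)
  set K : ℝ := (√(2 * Real.pi * σ ^ 2))⁻¹ ^ M with hK
  have hpt : ∀ y : Fin M → ℝ,
      ((fun y : Fin M → ℝ => ∏ i, gaussianPDF (m i) (σ ^ 2).toNNReal (y i)) *
        fun y : Fin M → ℝ => ENNReal.ofReal (Real.exp ((y - m) ⬝ᵥ (B *ᵥ (y - m)) / (4 * σ ^ 2)))) y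
      = (fun x => ENNReal.ofReal K * ENNReal.ofReal
          (Real.exp (-((1 / σ ^ 2) / 2) * (x ⬝ᵥ ((1 - (1 / 2 : ℝ) • B) *ᵥ x))))) (y - m) := by
    intro y
    simp only [Pi.mul_apply, gaussianPDF]
    rw [← ENNReal.ofReal_prod_of_nonneg fun i _ => gaussianPDFReal_nonneg _ _ _,
      ← ENNReal.ofReal_mul (Finset.prod_nonneg fun i _ => gaussianPDFReal_nonneg _ _ _),
      ← ENNReal.ofReal_mul (by positivity)]
    congr 1
    simp only [gaussianPDFReal, hv]
    rw [Finset.prod_mul_distrib, Finset.prod_const, Finset.card_univ, Fintype.card_fin, ← hK,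
      ← Real.exp_sum, mul_assoc, ← Real.exp_add]
    congr 2
    rw [Matrix.sub_mulVec, Matrix.one_mulVec, Matrix.smul_mulVec, dotProduct_sub,
      dotProduct_smul, ← sqNorm_eq_dotProduct, sqNorm, ← Finset.sum_div, Finset.sum_neg_distrib]
    simp only [Pi.sub_apply, smul_eq_mul]
    field_simp
    ring
  simp_rw [hpt]
  rw [lintegral_sub_right_eq_self (fun x => ENNReal.ofReal K * ENNReal.ofReal
    (Real.exp (-((1 / σ ^ 2) / 2) * (x ⬝ᵥ ((1 - (1 / 2 : ℝ) • B) *ᵥ x))))) m,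
    lintegral_const_mul' _ _ ENNReal.ofReal_ne_top, lintegral_exp_neg_quadratic hB (by positivity),
    ← ENNReal.ofReal_mul (by positivity)]
  congr 1
  have h1 : √(2 * Real.pi * σ ^ 2) = √(2 * Real.pi) * σ := by
    rw [Real.sqrt_mul (by positivity), Real.sqrt_sq hσ.le]
  have h2 : √(1 / σ ^ 2) = σ⁻¹ := by
    rw [one_div, Real.sqrt_inv, Real.sqrt_sq hσ.le]
  have h3 : √(2 * Real.pi) ≠ 0 := by positivity
  have h4 : √(1 - (1 / 2 : ℝ) • B).det ≠ 0 := (Real.sqrt_pos.2 hB.det_pos).ne'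
  rw [hK, h1, h2, inv_pow, inv_pow, mul_pow]
  field_simp

/-- Chernoff bound for a quadratic form in Gaussian noise. -/
theorem isoGaussian_quadratic_tail {B : Matrix (Fin M) (Fin M) ℝ}
    (hB : (1 - (1 / 2 : ℝ) • B).PosDef) (m : Fin M → ℝ) {σ : ℝ} (hσ : 0 < σ) (t : ℝ) :
    isoGaussian m σ {y | σ ^ 2 * t ≤ (y - m) ⬝ᵥ (B *ᵥ (y - m))}
      ≤ ENNReal.ofReal (Real.exp (-t / 4) / √(1 - (1 / 2 : ℝ) • B).det) := by
  have hsub : {y | σ ^ 2 * t ≤ (y - m) ⬝ᵥ (B *ᵥ (y - m))} ⊆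
      {y | 1 ≤ ENNReal.ofReal (Real.exp (-t / 4)) *
        ENNReal.ofReal (Real.exp ((y - m) ⬝ᵥ (B *ᵥ (y - m)) / (4 * σ ^ 2)))} := by
    intro y hy
    simp only [mem_ofPred_eq] at hy ⊢
    rw [← ENNReal.ofReal_mul (Real.exp_pos _).le, ← Real.exp_add, ENNReal.one_le_ofReal,
      Real.one_le_exp_iff]
    have : t / 4 ≤ (y - m) ⬝ᵥ (B *ᵥ (y - m)) / (4 * σ ^ 2) := by
      rw [div_le_div_iff₀ (by norm_num) (by positivity)]
      linarith
    linarith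
  have hmB : Measurable fun y : Fin M → ℝ => ENNReal.ofReal (Real.exp (-t / 4)) *
      ENNReal.ofReal (Real.exp ((y - m) ⬝ᵥ (B *ᵥ (y - m)) / (4 * σ ^ 2))) := by
    have : Continuous fun y : Fin M → ℝ => (y - m) ⬝ᵥ (B *ᵥ (y - m)) := by
      refine Continuous.dotProduct (by fun_prop) (Continuous.matrix_mulVec (by fun_prop)
        (by fun_prop))
    exact (ENNReal.measurable_ofReal.comp
      (Real.measurable_exp.comp (this.measurable.div_const _))).const_mul _
  refine (measure_mono hsub).trans ?_
  have h := mul_meas_ge_le_lintegral hmB (μ := isoGaussian m σ) 1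
  rw [one_mul, lintegral_const_mul' _ _ ENNReal.ofReal_ne_top,
    lintegral_exp_quadratic_isoGaussian hB m hσ, ← ENNReal.ofReal_mul (Real.exp_pos _).le,
    mul_one_div] at h
  exact h

/-- With fewer than `M` covariates the residual almost surely does not vanish. -/
theorem isoGaussian_rss_eq_zero {l : ℕ} (hl : l < M) (Z : Matrix (Fin M) (Fin l) ℝ)
    (m : Fin M → ℝ) {σ : ℝ} (hσ : 0 < σ) : isoGaussian m σ {y | rss Z y = 0} = 0 := by
  refine isoGaussian_absolutelyContinuous m hσ ?_
  refine measure_mono_null (t := (LinearMap.range (Matrix.toLin' Z) : Set (Fin M → ℝ))) ?_ ?_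
  · intro y hy
    have hz : y - Z *ᵥ ols Z y = 0 := by
      by_contra hne
      exact (sqNorm_pos hne).ne' hy
    exact ⟨ols Z y, by rw [Matrix.toLin'_apply]; exact (sub_eq_zero.1 hz).symm⟩
  · refine Measure.addHaar_submodule _ _ fun htop => ?_
    have h := LinearMap.finrank_range_le (Matrix.toLin' Z)
    rw [htop, finrank_top, Module.finrank_fin_fun, Module.finrank_fin_fun] at h
    omega

end Noise

/-! ### Integrating out the coefficients and the precision -/

section Evidence

variable {M k : ℕ}

theorem likelihood_eq {W : Matrix (Fin M) (Fin k) ℝ} (hW : (gram W).PosDef) (y : Fin M → ℝ)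
    (v : Fin k → ℝ) (φ : ℝ) :
    likelihood W y v φ = φ ^ ((M : ℝ) / 2) * Real.exp (-(φ / 2) * rss W y) *
      Real.exp (-(φ / 2) * ((v - ols W y) ⬝ᵥ (gram W *ᵥ (v - ols W y)))) := by
  rw [likelihood, sqNorm_sub_mulVec hW, mul_assoc, ← Real.exp_add, sqNorm_mulVec]
  congr 2
  ring

/-- A Gaussian integral centred at the least squares estimator. -/
theorem lintegral_exp_neg_ols {W : Matrix (Fin M) (Fin k) ℝ} (hW : (gram W).PosDef)
    (y : Fin M → ℝ) {c : ℝ} (hc : 0 < c) :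
    ∫⁻ v, ENNReal.ofReal
        (Real.exp (-(c / 2) * ((v - ols W y) ⬝ᵥ (gram W *ᵥ (v - ols W y)))))
      = ENNReal.ofReal (√(2 * Real.pi) ^ k / (√c ^ k * √(gram W).det)) := by
  rw [lintegral_sub_right_eq_self (fun v => ENNReal.ofReal
    (Real.exp (-(c / 2) * (v ⬝ᵥ (gram W *ᵥ v))))) (ols W y)]
  exact lintegral_exp_neg_quadratic hW hc

/-- The likelihood integrated over all coefficient vectors. -/
theorem lintegral_likelihood {W : Matrix (Fin M) (Fin k) ℝ} (hW : (gram W).PosDef)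
    (y : Fin M → ℝ) {φ : ℝ} (hφ : 0 < φ) :
    ∫⁻ v, ENNReal.ofReal (likelihood W y v φ)
      = ENNReal.ofReal (φ ^ ((M : ℝ) / 2) * Real.exp (-(φ / 2) * rss W y) *
          (√(2 * Real.pi) ^ k / (√φ ^ k * √(gram W).det))) := by
  have hnn : 0 ≤ φ ^ ((M : ℝ) / 2) * Real.exp (-(φ / 2) * rss W y) := by positivity
  simp_rw [likelihood_eq hW, ENNReal.ofReal_mul hnn]
  rw [lintegral_const_mul' _ _ ENNReal.ofReal_ne_top, lintegral_exp_neg_ols hW y hφ]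

/-- The powers of the precision contributed by the prior, the likelihood and the Gaussian integral
over `k` coordinates add up to an exponent that does not depend on `k`. -/
theorem precisionPrior_mul {W : Matrix (Fin M) (Fin k) ℝ} (y : Fin M → ℝ) (κ₁ κ₂ : ℝ) {φ : ℝ}
    (hφ : 0 < φ) :
    precisionPrior κ₁ κ₂ (k + 1) φ * (φ ^ ((M : ℝ) / 2) * Real.exp (-(φ / 2) * rss W y) *
        (√(2 * Real.pi) ^ k / (√φ ^ k * √(gram W).det)))
      = √(2 * Real.pi) ^ k / √(gram W).det *
        (φ ^ ((κ₁ + M) / 2 - 1) * Real.exp (-(φ / 2) * (κ₂ + rss W y))) := by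
  have h1 : √φ ^ k = φ ^ ((k : ℝ) / 2) := by
    rw [Real.sqrt_eq_rpow, ← Real.rpow_natCast, ← Real.rpow_mul hφ.le]
    congr 1
    ring
  have h2 : φ ^ ((κ₁ + M) / 2 - 1) * φ ^ ((k : ℝ) / 2)
      = φ ^ ((κ₁ + ((k + 1 : ℕ) : ℝ) - 1) / 2 - 1) * φ ^ ((M : ℝ) / 2) := by
    rw [← Real.rpow_add hφ, ← Real.rpow_add hφ]
    congr 1
    push_cast
    ring
  have h3 : Real.exp (-(φ / 2) * (κ₂ + rss W y))
      = Real.exp (-φ * κ₂ / 2) * Real.exp (-(φ / 2) * rss W y) := by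
    rw [← Real.exp_add]; congr 1; ring
  have h4 : φ ^ ((k : ℝ) / 2) ≠ 0 := (Real.rpow_pos_of_pos hφ _).ne'
  rw [precisionPrior, h1, h3]
  rw [show φ ^ ((κ₁ + ((k + 1 : ℕ) : ℝ) - 1) / 2 - 1) * Real.exp (-φ * κ₂ / 2) *
      (φ ^ ((M : ℝ) / 2) * Real.exp (-(φ / 2) * rss W y) *
        (√(2 * Real.pi) ^ k / (φ ^ ((k : ℝ) / 2) * √(gram W).det)))
      = (φ ^ ((κ₁ + ((k + 1 : ℕ) : ℝ) - 1) / 2 - 1) * φ ^ ((M : ℝ) / 2)) / φ ^ ((k : ℝ) / 2) *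
        (Real.exp (-φ * κ₂ / 2) * Real.exp (-(φ / 2) * rss W y)) *
        (√(2 * Real.pi) ^ k / √(gram W).det) by ring, ← h2, mul_div_cancel_right₀ _ h4]
  ring

theorem precisionPrior_nonneg (κ₁ κ₂ : ℝ) (l : ℕ) {φ : ℝ} (hφ : 0 < φ) :
    0 ≤ precisionPrior κ₁ κ₂ l φ := by
  unfold precisionPrior; positivity

/-- The posterior mass, up to model prior factors, when the coefficients range over all of
`ℝᵏ`. -/
theorem lintegral_precisionPrior_mul_lintegral_likelihood {W : Matrix (Fin M) (Fin k) ℝ}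
    (hW : (gram W).PosDef) (y : Fin M → ℝ) {κ₁ κ₂ : ℝ} (ha : 0 < (κ₁ + M) / 2)
    (hb : 0 < κ₂ + rss W y) :
    ∫⁻ φ in Ioi (0 : ℝ), ENNReal.ofReal (precisionPrior κ₁ κ₂ (k + 1) φ) *
        ∫⁻ v, ENNReal.ofReal (likelihood W y v φ)
      = ENNReal.ofReal (√(2 * Real.pi) ^ k / √(gram W).det *
          (Real.Gamma ((κ₁ + M) / 2) * (2 / (κ₂ + rss W y)) ^ ((κ₁ + M) / 2))) := by
  have hK : 0 ≤ √(2 * Real.pi) ^ k / √(gram W).det := by positivity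
  rw [ENNReal.ofReal_mul hK, ← lintegral_rpow_mul_exp_neg_mul ha hb,
    ← lintegral_const_mul' _ _ ENNReal.ofReal_ne_top]
  refine setLIntegral_congr_fun measurableSet_Ioi fun φ (hφ : 0 < φ) => ?_
  rw [lintegral_likelihood hW y hφ, ← ENNReal.ofReal_mul (precisionPrior_nonneg _ _ _ hφ),
    precisionPrior_mul y κ₁ κ₂ hφ, ENNReal.ofReal_mul hK]

theorem sqrt_half_le_pow (k : ℕ) :
    √(1 / 2) ≤ √(1 - 1 / (2 * ((k : ℝ) + 1))) ^ k := by
  set t : ℝ := 1 - 1 / (2 * ((k : ℝ) + 1)) with ht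
  have hk : (0 : ℝ) < (k : ℝ) + 1 := by positivity
  have h1 : 1 / (2 * ((k : ℝ) + 1)) ≤ 1 / 2 := by
    apply one_div_le_one_div_of_le <;> linarith [(Nat.cast_nonneg k : (0 : ℝ) ≤ k)]
  have h2 : 0 ≤ 1 / (2 * ((k : ℝ) + 1)) := by positivity
  have ht0 : 0 ≤ t := by linarith
  have ht1 : t ≤ 1 := by linarith
  have hb : 1 / 2 ≤ t ^ (k + 1) := by
    have := one_add_mul_le_pow (a := -(1 / (2 * ((k : ℝ) + 1)))) (by linarith) (k + 1)
    have h3 : 1 + ((k + 1 : ℕ) : ℝ) * -(1 / (2 * ((k : ℝ) + 1))) = 1 / 2 := by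
      push_cast; field_simp; ring
    rw [h3] at this
    simpa [ht, sub_eq_add_neg] using this
  have h4 : t ^ (k + 1) ≤ t ^ k := pow_le_pow_of_le_one ht0 ht1 (Nat.le_succ k)
  have h5 : √t ^ k = √(t ^ k) := by
    rw [eq_comm, Real.sqrt_eq_iff_mul_self_eq (by positivity) (by positivity), ← mul_pow,
      Real.mul_self_sqrt ht0]
  rw [h5]
  exact Real.sqrt_le_sqrt (hb.trans h4)

theorem four_mul_exp_neg_one_mul_sqrt_two_le : 4 * Real.exp (-1) * √2 ≤ 2.1 := by
  have h1 : Real.exp (-1) < 0.3679 := by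
    have := Real.exp_neg_one_lt_d9
    linarith
  have h2 : √2 ≤ 1.4143 := by
    rw [Real.sqrt_le_left (by norm_num)]; norm_num
  have h3 := Real.sqrt_nonneg 2
  have := Real.exp_pos (-1)
  nlinarith

/-- Tail bound for the Gaussian with precision matrix `φ WᵀW`: Markov's inequality for
`‖W (v - v̂)‖²`, the mean of which is of order `k / φ`. The mean is bounded by means of
`x ≤ exp (x - 1)` at `x = φ ‖W (v - v̂)‖² / (4 (k + 1))`, which only inflates the Gaussian. -/
theorem setLIntegral_likelihood_le {W : Matrix (Fin M) (Fin k) ℝ} (hW : (gram W).PosDef)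
    (y : Fin M → ℝ) {φ R : ℝ} (hφ : 0 < φ) (hR : 0 < R) :
    ∫⁻ v in {v | R ^ 2 < sqNorm (W *ᵥ (v - ols W y))}, ENNReal.ofReal (likelihood W y v φ)
      ≤ ENNReal.ofReal (2.1 * ((k : ℝ) + 1) / (φ * R ^ 2) *
          (φ ^ ((M : ℝ) / 2) * Real.exp (-(φ / 2) * rss W y) *
            (√(2 * Real.pi) ^ k / (√φ ^ k * √(gram W).det)))) := by
  have hk : (0 : ℝ) < (k : ℝ) + 1 := by positivity
  set t : ℝ := 1 - 1 / (2 * ((k : ℝ) + 1)) with ht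
  have ht0 : 0 < t := by
    have : 1 / (2 * ((k : ℝ) + 1)) ≤ 1 / 2 := by
      apply one_div_le_one_div_of_le <;> linarith [(Nat.cast_nonneg k : (0 : ℝ) ≤ k)]
    linarith
  set C : ℝ := φ ^ ((M : ℝ) / 2) * Real.exp (-(φ / 2) * rss W y) with hC
  have hC0 : 0 ≤ C := by positivity
  set D : ℝ := 4 * ((k : ℝ) + 1) / (φ * R ^ 2) * Real.exp (-1) with hD
  have hD0 : 0 ≤ D := by positivity
  calc ∫⁻ v in {v | R ^ 2 < sqNorm (W *ᵥ (v - ols W y))}, ENNReal.ofReal (likelihood W y v φ)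
      ≤ ∫⁻ v in {v | R ^ 2 < sqNorm (W *ᵥ (v - ols W y))}, ENNReal.ofReal (C * D) *
          ENNReal.ofReal (Real.exp (-(φ * t / 2) *
            ((v - ols W y) ⬝ᵥ (gram W *ᵥ (v - ols W y))))) := by
        refine setLIntegral_mono' ?_ fun v hv => ?_
        · have : Continuous fun v => sqNorm (W *ᵥ (v - ols W y)) :=
            continuous_sqNorm.comp (Continuous.matrix_mulVec continuous_const (by fun_prop))
          exact (isOpen_lt continuous_const this).measurableSet
        · rw [likelihood_eq hW, ← ENNReal.ofReal_mul (by positivity)]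
          refine ENNReal.ofReal_le_ofReal ?_
          rw [← hC, mul_assoc C D]
          refine mul_le_mul_of_nonneg_left ?_ hC0
          have hv' : R ^ 2 < sqNorm (W *ᵥ (v - ols W y)) := hv
          rw [sqNorm_mulVec] at hv'
          set Q := (v - ols W y) ⬝ᵥ (gram W *ᵥ (v - ols W y))
          set x := φ * Q / (4 * ((k : ℝ) + 1)) with hx
          have h1 : x ≤ Real.exp (x - 1) := by linarith [Real.add_one_le_exp (x - 1)]
          have h2 : Real.exp (x - 1) = Real.exp (-1) * Real.exp x := by
            rw [← Real.exp_add]; congr 1; ring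
          have h3 : 1 ≤ D * Real.exp x := by
            have h4 : 4 * ((k : ℝ) + 1) / (φ * R ^ 2) * x = Q / R ^ 2 := by
              rw [hx]; field_simp
            have h5 : 1 ≤ Q / R ^ 2 := by
              rw [one_le_div (by positivity)]; exact hv'.le
            calc (1 : ℝ) ≤ 4 * ((k : ℝ) + 1) / (φ * R ^ 2) * x := by rw [h4]; exact h5
              _ ≤ 4 * ((k : ℝ) + 1) / (φ * R ^ 2) * (Real.exp (-1) * Real.exp x) := by
                rw [← h2]; gcongr
              _ = D * Real.exp x := by rw [hD]; ring
          have h6 : Real.exp (-(φ * t / 2) * Q) = Real.exp x * Real.exp (-(φ / 2) * Q) := by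
            rw [← Real.exp_add]; congr 1; rw [hx, ht]; field_simp; ring
          rw [h6, ← mul_assoc]
          exact le_mul_of_one_le_left (Real.exp_pos _).le h3
    _ ≤ ∫⁻ v, ENNReal.ofReal (C * D) *
          ENNReal.ofReal (Real.exp (-(φ * t / 2) *
            ((v - ols W y) ⬝ᵥ (gram W *ᵥ (v - ols W y))))) := setLIntegral_le_lintegral _ _
    _ = ENNReal.ofReal (C * D * (√(2 * Real.pi) ^ k / (√(φ * t) ^ k * √(gram W).det))) := by
        rw [lintegral_const_mul' _ _ ENNReal.ofReal_ne_top,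
          lintegral_exp_neg_ols hW y (by positivity), ← ENNReal.ofReal_mul (by positivity)]
    _ ≤ _ := by
        refine ENNReal.ofReal_le_ofReal ?_
        have hdet : 0 < √(gram W).det := Real.sqrt_pos.2 hW.det_pos
        have hp := sqrt_half_le_pow k
        rw [← ht] at hp
        have hs2 : (0 : ℝ) < √(1 / 2) := by positivity
        have hinv : 1 / √t ^ k ≤ √2 := by
          have : √2 = 1 / √(1 / 2) := by
            rw [Real.sqrt_div (by norm_num), Real.sqrt_one, one_div_one_div]
          rw [this]
          exact one_div_le_one_div_of_le hs2 hp
        have hsplit : C * D * (√(2 * Real.pi) ^ k / (√(φ * t) ^ k * √(gram W).det))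
            = (4 * Real.exp (-1) * (1 / √t ^ k)) * ((((k : ℝ) + 1) / (φ * R ^ 2)) *
              (C * (√(2 * Real.pi) ^ k / (√φ ^ k * √(gram W).det)))) := by
          rw [Real.sqrt_mul hφ.le, mul_pow, hD]
          have : √t ^ k ≠ 0 := (hs2.trans_le hp).ne'
          field_simp
        rw [hsplit, mul_div_assoc, mul_assoc 2.1]
        refine mul_le_mul_of_nonneg_right ?_ (by positivity)
        refine le_trans ?_ four_mul_exp_neg_one_mul_sqrt_two_le
        gcongr

/-- If a region of coefficients contains the ellipsoid of radius `R` around the least squares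
estimator, and `R` is large compared with the typical posterior deviation, then the region carries
at least half of the posterior mass. -/
theorem half_le_lintegral_of_ellipsoid_subset {W : Matrix (Fin M) (Fin k) ℝ}
    (hW : (gram W).PosDef) (y : Fin M → ℝ) {κ₁ κ₂ R : ℝ} (ha : 1 < (κ₁ + M) / 2)
    (hb : 0 < κ₂ + rss W y) (hR : 0 < R) {S : Set (Fin k → ℝ)}
    (hS : {v | sqNorm (W *ᵥ (v - ols W y)) ≤ R ^ 2} ⊆ S)
    (hδ : 2.1 * ((k : ℝ) + 1) * (κ₂ + rss W y) ≤ R ^ 2 * ((κ₁ + M) / 2 - 1)) :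
    ENNReal.ofReal (√(2 * Real.pi) ^ k / √(gram W).det *
        (Real.Gamma ((κ₁ + M) / 2) * (2 / (κ₂ + rss W y)) ^ ((κ₁ + M) / 2)) / 2)
      ≤ ∫⁻ φ in Ioi (0 : ℝ), ENNReal.ofReal (precisionPrior κ₁ κ₂ (k + 1) φ) *
          ∫⁻ v in S, ENNReal.ofReal (likelihood W y v φ) := by
  set a := (κ₁ + M) / 2 with ha_def
  set b := κ₂ + rss W y with hb_def
  set K := √(2 * Real.pi) ^ k / √(gram W).det with hK_def
  have hK : 0 ≤ K := by positivity
  set D := 2.1 * ((k : ℝ) + 1) / R ^ 2 with hD_def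
  have hD : 0 ≤ D := by positivity
  have hG := Real.Gamma_pos_of_pos (show 0 < a - 1 by linarith)
  set F := K * (Real.Gamma a * (2 / b) ^ a) with hF_def
  have hF0 : 0 ≤ F := by
    have := Real.Gamma_pos_of_pos (show 0 < a by linarith)
    positivity
  have hout : ∫⁻ φ in Ioi (0 : ℝ), ENNReal.ofReal (D * K) *
      ENNReal.ofReal (φ ^ (a - 1 - 1) * Real.exp (-(φ / 2) * b)) ≤ ENNReal.ofReal (F / 2) := by
    rw [lintegral_const_mul' _ _ ENNReal.ofReal_ne_top,
      lintegral_rpow_mul_exp_neg_mul (by linarith) hb, ← ENNReal.ofReal_mul (by positivity)]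
    refine ENNReal.ofReal_le_ofReal ?_
    have hGa : Real.Gamma a = (a - 1) * Real.Gamma (a - 1) := by
      have := Real.Gamma_add_one (show a - 1 ≠ 0 by linarith)
      rwa [sub_add_cancel] at this
    have hpow : (2 / b) ^ a = (2 / b) ^ (a - 1) * (2 / b) := by
      have := Real.rpow_add_one (show 2 / b ≠ 0 by positivity) (a - 1)
      rwa [sub_add_cancel] at this
    have hle : D ≤ (a - 1) * (2 / b) / 2 := by
      rw [hD_def, div_le_div_iff₀ (by positivity) (by norm_num)]
      rw [mul_div_assoc', div_mul_eq_mul_div, le_div_iff₀ hb]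
      linarith
    rw [hF_def, hGa, hpow]
    calc D * K * (Real.Gamma (a - 1) * (2 / b) ^ (a - 1))
        ≤ ((a - 1) * (2 / b) / 2) * K * (Real.Gamma (a - 1) * (2 / b) ^ (a - 1)) := by gcongr
      _ = _ := by ring
  have hfull := lintegral_precisionPrior_mul_lintegral_likelihood hW y
    (κ₁ := κ₁) (κ₂ := κ₂) (by linarith) hb
  rw [← ha_def, ← hb_def, ← hK_def, ← hF_def] at hfull
  have hle : ENNReal.ofReal F ≤
      (∫⁻ φ in Ioi (0 : ℝ), ENNReal.ofReal (precisionPrior κ₁ κ₂ (k + 1) φ) *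
          ∫⁻ v in S, ENNReal.ofReal (likelihood W y v φ)) +
      ∫⁻ φ in Ioi (0 : ℝ), ENNReal.ofReal (D * K) *
        ENNReal.ofReal (φ ^ (a - 1 - 1) * Real.exp (-(φ / 2) * b)) := by
    rw [← hfull, ← lintegral_add_right _ (by fun_prop)]
    refine setLIntegral_mono' measurableSet_Ioi fun φ (hφ : 0 < φ) => ?_
    have hcover : (univ : Set (Fin k → ℝ)) ⊆
        S ∪ {v | R ^ 2 < sqNorm (W *ᵥ (v - ols W y))} := fun v _ => by
      rcases le_or_gt (sqNorm (W *ᵥ (v - ols W y))) (R ^ 2) with h | h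
      · exact Or.inl (hS h)
      · exact Or.inr h
    have h1 : ∫⁻ v, ENNReal.ofReal (likelihood W y v φ) ≤
        (∫⁻ v in S, ENNReal.ofReal (likelihood W y v φ)) +
        ∫⁻ v in {v | R ^ 2 < sqNorm (W *ᵥ (v - ols W y))},
          ENNReal.ofReal (likelihood W y v φ) := by
      rw [← setLIntegral_univ]
      exact (lintegral_mono_set hcover).trans (lintegral_union_le _ _ _)
    refine (mul_le_mul_right h1 _).trans ?_
    rw [mul_add]
    refine add_le_add le_rfl ?_
    refine (mul_le_mul_right (setLIntegral_likelihood_le hW y hφ hR) _).trans ?_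
    rw [← ENNReal.ofReal_mul (precisionPrior_nonneg _ _ _ hφ), ← ENNReal.ofReal_mul (by positivity)]
    refine ENNReal.ofReal_le_ofReal (le_of_eq ?_)
    have hpow : φ ^ (a - 1) = φ ^ (a - 1 - 1) * φ := by
      have := Real.rpow_add_one hφ.ne' (a - 1 - 1)
      rwa [sub_add_cancel] at this
    rw [mul_left_comm, precisionPrior_mul y κ₁ κ₂ hφ, ← ha_def, ← hb_def, ← hK_def, hpow, hD_def]
    field_simp
  have hsplit : ENNReal.ofReal F = ENNReal.ofReal (F / 2) + ENNReal.ofReal (F / 2) := by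
    rw [← ENNReal.ofReal_add (by positivity) (by positivity), add_halves]
  have := hle.trans (add_le_add le_rfl hout)
  rw [hsplit] at this
  exact (ENNReal.add_le_add_iff_right ENNReal.ofReal_ne_top).1 this

end Evidence

/-! ### Posterior masses of models -/

section ModelMass

variable {M N k l : ℕ}

theorem measurable_simplexChart : Measurable (simplexChart : (Fin k → ℝ) → Fin (k + 1) → ℝ) := by
  refine measurable_pi_iff.2 fun i => ?_
  refine Fin.lastCases ?_ (fun i => ?_) i
  · simp only [simplexChart, Fin.snoc_last]; fun_prop
  · simp only [simplexChart, Fin.snoc_castSucc]; fun_prop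

theorem marginalLikelihood_eq_chart (Z : Matrix (Fin M) (Fin (k + 1)) ℝ) (y : Fin M → ℝ) (φ : ℝ) :
    marginalLikelihood Z y φ = ENNReal.ofReal (Real.Gamma ((k : ℝ) + 1)) *
      ∫⁻ v in solidSimplex k,
        ENNReal.ofReal (likelihood (chartDesign Z) (chartResponse Z y) v φ) := by
  have hmeas : Measurable fun u : Fin (k + 1) → ℝ => ENNReal.ofReal (likelihood Z y u φ) := by
    have : Continuous fun u : Fin (k + 1) → ℝ => likelihood Z y u φ := by
      unfold likelihood
      have h : Continuous fun u : Fin (k + 1) → ℝ => sqNorm (y - Z *ᵥ u) :=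
        continuous_sqNorm.comp
          (continuous_const.sub (Continuous.matrix_mulVec continuous_const continuous_id))
      fun_prop
    exact ENNReal.measurable_ofReal.comp this.measurable
  unfold marginalLikelihood
  change ∫⁻ u, _ ∂(Measure.map simplexChart _) = _
  rw [lintegral_map hmeas measurable_simplexChart, lintegral_smul_measure, smul_eq_mul]
  simp only [likelihood, sub_mulVec_simplexChart]

theorem lintegral_precisionPrior_mul_marginalLikelihood (Z : Matrix (Fin M) (Fin (k + 1)) ℝ)
    (y : Fin M → ℝ) (κ₁ κ₂ : ℝ) :
    ∫⁻ φ in Ioi (0 : ℝ), ENNReal.ofReal (precisionPrior κ₁ κ₂ (k + 1) φ) *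
        marginalLikelihood Z y φ
      = ENNReal.ofReal (Real.Gamma ((k : ℝ) + 1)) *
        ∫⁻ φ in Ioi (0 : ℝ), ENNReal.ofReal (precisionPrior κ₁ κ₂ (k + 1) φ) *
          ∫⁻ v in solidSimplex k,
            ENNReal.ofReal (likelihood (chartDesign Z) (chartResponse Z y) v φ) := by
  rw [← lintegral_const_mul' _ _ ENNReal.ofReal_ne_top]
  refine lintegral_congr fun φ => ?_
  rw [marginalLikelihood_eq_chart, mul_left_comm]

theorem simplexChart_init {u : Fin (k + 1) → ℝ} (hu : ∑ i, u i = 1) :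
    simplexChart (fun i : Fin k => u i.castSucc) = u := by
  ext i
  refine Fin.lastCases ?_ (fun i => ?_) i
  · rw [Fin.sum_univ_castSucc] at hu
    simp only [simplexChart, Fin.snoc_last]
    linarith
  · simp [simplexChart]

theorem mem_solidSimplex_of_simplexChart_nonneg {v : Fin k → ℝ} (h : ∀ i, 0 ≤ simplexChart v i) :
    v ∈ solidSimplex k := by
  refine ⟨fun i => by simpa [simplexChart] using h i.castSucc, ?_⟩
  have := h (Fin.last k)
  simp only [simplexChart, Fin.snoc_last] at this
  linarith

/-- Restricting the coefficients to the hyperplane `∑ uᵢ = 1` increases the residual. -/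
theorem rss_le_rss_chart {Z : Matrix (Fin M) (Fin (k + 1)) ℝ} (hZ : (gram Z).PosDef)
    (y : Fin M → ℝ) : rss Z y ≤ rss (chartDesign Z) (chartResponse Z y) := by
  conv_rhs => rw [rss, ← sub_mulVec_simplexChart]
  exact rss_le hZ _ _

/-- The factor of the model prior that offsets the volume of the simplex and the Gaussian
normalization. -/
theorem model_factor_mul_gamma {Z : Matrix (Fin M) (Fin (k + 1)) ℝ} (hZ : (gram Z).PosDef)
    (x : ℝ) :
    (Real.Gamma ((k + 1 : ℕ) : ℝ))⁻¹ * √((1 : Fin (k + 1) → ℝ) ⬝ᵥ ((gram Z)⁻¹ *ᵥ 1)) *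
        √(gram Z).det * (Real.Gamma ((k : ℝ) + 1) * (x / √(gram (chartDesign Z)).det)) = x := by
  have hH := (gram_chartDesign_posDef hZ).det_pos
  have hdet := det_gram_chartDesign hZ
  have hs : √(gram (chartDesign Z)).det
      = √((1 : Fin (k + 1) → ℝ) ⬝ᵥ ((gram Z)⁻¹ *ᵥ 1)) * √(gram Z).det := by
    rw [hdet, Real.sqrt_mul' _ hZ.det_pos.le]
  have hH' : √(gram (chartDesign Z)).det ≠ 0 := (Real.sqrt_pos.2 hH).ne'
  have hG : Real.Gamma ((k : ℝ) + 1) ≠ 0 := (Real.Gamma_pos_of_pos (by positivity)).ne'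
  push_cast
  rw [mul_assoc _ (√_) (√_), ← hs]
  field_simp

/-- The factor of the prior weight of a model that depends on its design matrix. -/
noncomputable def designFactor (Z : Matrix (Fin M) (Fin l) ℝ) : ℝ :=
  (Real.Gamma (l : ℝ))⁻¹ * √((1 : Fin l → ℝ) ⬝ᵥ ((gram Z)⁻¹ *ᵥ 1)) * √(gram Z).det

theorem designFactor_nonneg (Z : Matrix (Fin M) (Fin l) ℝ) : 0 ≤ designFactor Z := by
  have : 0 ≤ Real.Gamma (l : ℝ) := Real.Gamma_nonneg_of_nonneg (Nat.cast_nonneg l)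
  unfold designFactor
  positivity

/-- Upper bound on the evidence of a model: extend the simplex to the whole hyperplane. -/
theorem evidence_le {Z : Matrix (Fin M) (Fin l) ℝ} (hl : 1 ≤ l) (hZ : (gram Z).PosDef)
    (y : Fin M → ℝ) {κ₁ κ₂ : ℝ} (ha : 0 < (κ₁ + M) / 2) (hb : 0 < κ₂ + rss Z y) :
    ENNReal.ofReal (designFactor Z) *
        ∫⁻ φ in Ioi (0 : ℝ), ENNReal.ofReal (precisionPrior κ₁ κ₂ l φ) * marginalLikelihood Z y φ
      ≤ ENNReal.ofReal (√(2 * Real.pi) ^ (l - 1) *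
          (Real.Gamma ((κ₁ + M) / 2) * (2 / (κ₂ + rss Z y)) ^ ((κ₁ + M) / 2))) := by
  obtain ⟨k, rfl⟩ : ∃ k, l = k + 1 := ⟨l - 1, by omega⟩
  have hW := gram_chartDesign_posDef hZ
  have hrss := rss_le_rss_chart hZ y
  have hG : 0 ≤ Real.Gamma ((k : ℝ) + 1) := (Real.Gamma_pos_of_pos (by positivity)).le
  have hGa : 0 < Real.Gamma ((κ₁ + M) / 2) := Real.Gamma_pos_of_pos ha
  have hb' : 0 < κ₂ + rss (chartDesign Z) (chartResponse Z y) := by linarith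
  rw [lintegral_precisionPrior_mul_marginalLikelihood]
  have h1 : ∫⁻ φ in Ioi (0 : ℝ), ENNReal.ofReal (precisionPrior κ₁ κ₂ (k + 1) φ) *
          ∫⁻ v in solidSimplex k,
            ENNReal.ofReal (likelihood (chartDesign Z) (chartResponse Z y) v φ)
      ≤ ∫⁻ φ in Ioi (0 : ℝ), ENNReal.ofReal (precisionPrior κ₁ κ₂ (k + 1) φ) *
          ∫⁻ v, ENNReal.ofReal (likelihood (chartDesign Z) (chartResponse Z y) v φ) :=
    lintegral_mono fun φ => mul_le_mul_right (setLIntegral_le_lintegral _ _) _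
  refine (mul_le_mul_right (mul_le_mul_right h1 _) _).trans ?_
  rw [lintegral_precisionPrior_mul_lintegral_likelihood hW _ ha hb', ← ENNReal.ofReal_mul hG,
    ← ENNReal.ofReal_mul (designFactor_nonneg Z)]
  refine ENNReal.ofReal_le_ofReal ?_
  rw [div_mul_eq_mul_div, designFactor, model_factor_mul_gamma hZ, Nat.add_sub_cancel]
  gcongr

/-- Lower bound on the evidence of the true model. If the weights `u` exceed both the estimation
error and the posterior spread, the simplex contains an ellipsoid carrying half of the Gaussian
posterior, and the restriction to the hyperplane costs at most the projected noise energy `T`. -/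
theorem le_evidence {Z : Matrix (Fin M) (Fin l) ℝ} (hl : 1 ≤ l) {c : ℝ} (hc : 0 < c)
    (hZc : ∀ u, c * sqNorm u ≤ sqNorm (Z *ᵥ u)) (y : Fin M → ℝ) {κ₁ κ₂ R T ρ : ℝ}
    {u : Fin l → ℝ} (hsum : ∑ i, u i = 1) (hρ : ∀ i, ρ ≤ u i)
    (hT : sqNorm (Z *ᵥ ols Z (y - Z *ᵥ u)) ≤ T) (hR : 0 < R) (hRT : R + √T ≤ √c * ρ)
    (ha : 1 < (κ₁ + M) / 2) (hb : 0 < κ₂ + rss Z y)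
    (hδ : 2.1 * (l : ℝ) * (κ₂ + sqNorm (y - Z *ᵥ u)) ≤ R ^ 2 * ((κ₁ + M) / 2 - 1)) :
    ENNReal.ofReal (√(2 * Real.pi) ^ (l - 1) *
        (Real.Gamma ((κ₁ + M) / 2) * (2 / (κ₂ + rss Z y + T)) ^ ((κ₁ + M) / 2)) / 2)
      ≤ ENNReal.ofReal (designFactor Z) *
        ∫⁻ φ in Ioi (0 : ℝ), ENNReal.ofReal (precisionPrior κ₁ κ₂ l φ) *
          marginalLikelihood Z y φ := by
  obtain ⟨k, rfl⟩ : ∃ k, l = k + 1 := ⟨l - 1, by omega⟩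
  have hZ := gram_posDef_of_le hc hZc
  have hW := gram_chartDesign_posDef hZ
  set W := chartDesign Z with hWdef
  set y' := chartResponse Z y with hy'
  set w : Fin k → ℝ := fun i => u i.castSucc with hw
  have hwu : simplexChart w = u := simplexChart_init hsum
  have hrss : rss Z y ≤ rss W y' := rss_le_rss_chart hZ y
  have hpyth : sqNorm (y - Z *ᵥ u) = rss W y' + sqNorm (W *ᵥ (w - ols W y')) := by
    rw [← sqNorm_sub_mulVec hW, ← sub_mulVec_simplexChart, hwu]
  have hfit := rss_add_sqNorm_fit hZ y u
  have hspread : sqNorm (W *ᵥ (w - ols W y')) ≤ T := by linarith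
  have hrssT : rss W y' ≤ rss Z y + T := by
    linarith [sqNorm_nonneg (W *ᵥ (w - ols W y'))]
  have hrssE : rss W y' ≤ sqNorm (y - Z *ᵥ u) := by
    linarith [sqNorm_nonneg (W *ᵥ (w - ols W y'))]
  have hT0 : 0 ≤ T := (sqNorm_nonneg _).trans hT
  have hG : 0 < Real.Gamma ((k : ℝ) + 1) := Real.Gamma_pos_of_pos (by positivity)
  have hGa : 0 < Real.Gamma ((κ₁ + M) / 2) := Real.Gamma_pos_of_pos (by linarith)
  have hb' : 0 < κ₂ + rss W y' := by linarith
  -- each coordinate of the chart moves by at most `r / √c` when `W v` moves by at most `r`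
  have hcoord : ∀ (v : Fin k → ℝ) (r : ℝ), 0 ≤ r → sqNorm (W *ᵥ (v - ols W y')) ≤ r ^ 2 →
      ∀ i, √c * |simplexChart v i - simplexChart (ols W y') i| ≤ r := by
    intro v r hr h i
    rw [hWdef, chartDesign_mulVec_sub] at h
    have h1 := (hZc _).trans h
    have h2 := sq_apply_le_sqNorm (simplexChart v - simplexChart (ols W y')) i
    have h3 : (√c * |simplexChart v i - simplexChart (ols W y') i|) ^ 2 ≤ r ^ 2 := by
      rw [mul_pow, Real.sq_sqrt hc.le, sq_abs]
      exact (mul_le_mul_of_nonneg_left h2 hc.le).trans h1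
    exact abs_le_of_sq_le_sq' h3 hr |>.2
  have hS : {v | sqNorm (W *ᵥ (v - ols W y')) ≤ R ^ 2} ⊆ solidSimplex k := by
    intro v hv
    refine mem_solidSimplex_of_simplexChart_nonneg fun i => ?_
    have h1 := hcoord v R hR.le hv i
    have h2 := hcoord w √T (Real.sqrt_nonneg _) (by rwa [Real.sq_sqrt hT0]) i
    rw [hwu] at h2
    have hsc : 0 < √c := Real.sqrt_pos.2 hc
    have h3 : √c * (u i - simplexChart v i) ≤ √c * ρ := by
      have h4 : u i - simplexChart v i ≤ |simplexChart v i - simplexChart (ols W y') i|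
          + |u i - simplexChart (ols W y') i| := by
        have := neg_abs_le (simplexChart v i - simplexChart (ols W y') i)
        have := le_abs_self (u i - simplexChart (ols W y') i)
        linarith
      have := mul_le_mul_of_nonneg_left h4 hsc.le
      rw [mul_add] at this
      linarith
    have h5 := le_of_mul_le_mul_left h3 hsc
    linarith [hρ i]
  have hδ' : 2.1 * ((k : ℝ) + 1) * (κ₂ + rss W y') ≤ R ^ 2 * ((κ₁ + M) / 2 - 1) := by
    refine le_trans ?_ hδ
    push_cast
    gcongr
  rw [lintegral_precisionPrior_mul_marginalLikelihood]
  refine le_trans ?_ (mul_le_mul_right (mul_le_mul_right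
    (half_le_lintegral_of_ellipsoid_subset hW y' ha hb' hR hS hδ') _) _)
  rw [← ENNReal.ofReal_mul hG.le, ← ENNReal.ofReal_mul (designFactor_nonneg Z)]
  refine ENNReal.ofReal_le_ofReal ?_
  rw [div_mul_eq_mul_div, div_right_comm, designFactor, model_factor_mul_gamma hZ,
    Nat.add_sub_cancel]
  have h2 : 2 / (κ₂ + rss Z y + T) ≤ 2 / (κ₂ + rss W y') := by
    apply div_le_div_of_nonneg_left (by norm_num) hb'
    linarith
  gcongr

theorem modelPrior_eq {X : Matrix (Fin M) (Fin N) ℝ} {L : ℕ} {γ : Finset (Fin N)} (θ : ℝ)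
    (hγ : γ ∈ sparseModels N L) :
    modelPrior X L θ γ =
      θ ^ γ.card * (1 - θ) ^ (N - γ.card) * designFactor (subdesign X γ) := by
  rw [modelPrior, if_pos hγ, designFactor]
  ring

end ModelMass

/-! ### Posterior ratios -/

section PosteriorRatio

variable {M N : ℕ}

theorem posteriorMass_eq (X : Matrix (Fin M) (Fin N) ℝ) {L : ℕ} {θ : ℝ} (hθ0 : 0 < θ)
    (hθ1 : θ < 1) (κ₁ κ₂ : ℝ) (y : Fin M → ℝ) {γ : Finset (Fin N)} (hγ : γ ∈ sparseModels N L) :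
    posteriorMass X L θ κ₁ κ₂ y γ = ENNReal.ofReal (θ ^ γ.card * (1 - θ) ^ (N - γ.card)) *
      (ENNReal.ofReal (designFactor (subdesign X γ)) *
        ∫⁻ φ in Ioi (0 : ℝ), ENNReal.ofReal (precisionPrior κ₁ κ₂ γ.card φ) *
          marginalLikelihood (subdesign X γ) y φ) := by
  have : 0 < 1 - θ := by linarith
  rw [posteriorMass, modelPrior_eq θ hγ, ENNReal.ofReal_mul (by positivity), mul_assoc]

/-- The size penalty of the model prior, collected into powers of the prior odds. -/
theorem size_penalty_eq {θ : ℝ} (hθ1 : θ < 1) {l : ℕ} (hl : 1 ≤ l) (hlN : l ≤ N) :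
    θ ^ l * (1 - θ) ^ (N - l) * √(2 * Real.pi) ^ (l - 1)
      = (θ * √(2 * Real.pi) / (1 - θ)) ^ l * ((1 - θ) ^ N / √(2 * Real.pi)) := by
  have h1 : 0 < 1 - θ := by linarith
  have h2 : √(2 * Real.pi) ≠ 0 := by positivity
  obtain ⟨k, rfl⟩ : ∃ k, l = k + 1 := ⟨l - 1, by omega⟩
  obtain ⟨n, rfl⟩ : ∃ n, N = k + 1 + n := ⟨N - (k + 1), by omega⟩
  rw [Nat.add_sub_cancel, Nat.add_sub_cancel_left, div_pow, mul_pow, pow_add (1 - θ) (k + 1) n,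
    pow_succ (√(2 * Real.pi)) k]
  field_simp

/-- The normalization of the posterior and all factors common to the models cancel in the ratio of
the upper bound `evidence_le` for `γ` and a matching lower bound for `γs`. The lower bound also
makes the normalization nonzero, so that the ratio of real numbers is the ratio of masses. -/
theorem modelPosterior_ratio_le {X : Matrix (Fin M) (Fin N) ℝ} {L : ℕ} {θ κ₁ κ₂ T : ℝ}
    {y : Fin M → ℝ} {γs : Finset (Fin N)} (hθ0 : 0 < θ) (hθ1 : θ < 1)
    (hγs : γs ∈ sparseModels N L)
    (hpd : ∀ γ ∈ sparseModels N L, (gram (subdesign X γ)).PosDef)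
    (ha : 0 < (κ₁ + M) / 2) (hb : ∀ γ ∈ sparseModels N L, 0 < κ₂ + rss (subdesign X γ) y)
    (hT : 0 ≤ T)
    (hlow : ENNReal.ofReal (√(2 * Real.pi) ^ (γs.card - 1) * (Real.Gamma ((κ₁ + M) / 2) *
          (2 / (κ₂ + rss (subdesign X γs) y + T)) ^ ((κ₁ + M) / 2)) / 2)
      ≤ ENNReal.ofReal (designFactor (subdesign X γs)) *
        ∫⁻ φ in Ioi (0 : ℝ), ENNReal.ofReal (precisionPrior κ₁ κ₂ γs.card φ) *
          marginalLikelihood (subdesign X γs) y φ) :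
    0 < modelPosterior X L θ κ₁ κ₂ y γs ∧ ∀ γ ∈ sparseModels N L,
      modelPosterior X L θ κ₁ κ₂ y γ / modelPosterior X L θ κ₁ κ₂ y γs ≤
        2 * (θ * √(2 * Real.pi) / (1 - θ)) ^ ((γ.card : ℤ) - (γs.card : ℤ)) *
          ((κ₂ + rss (subdesign X γs) y + T) / (κ₂ + rss (subdesign X γ) y)) ^
            ((κ₁ + (M : ℝ)) / 2) := by
  have hθ : 0 < 1 - θ := by linarith
  have hG : 0 < Real.Gamma ((κ₁ + M) / 2) := Real.Gamma_pos_of_pos ha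
  have hcard : ∀ γ ∈ sparseModels N L, 1 ≤ γ.card ∧ γ.card ≤ N := fun γ hγ =>
    ⟨(Finset.mem_filter.1 hγ).2.1, by simpa using Finset.card_le_univ γ⟩
  set r := θ * √(2 * Real.pi) / (1 - θ) with hr
  have hr0 : 0 < r := by positivity
  set q := (1 - θ) ^ N / √(2 * Real.pi) with hq
  have hq0 : 0 < q := by positivity
  set a := (κ₁ + (M : ℝ)) / 2 with ha_def
  set U : Finset (Fin N) → ℝ := fun γ => r ^ γ.card * q *
    (Real.Gamma a * (2 / (κ₂ + rss (subdesign X γ) y)) ^ a) with hU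
  have hUnn : ∀ γ ∈ sparseModels N L, 0 ≤ U γ := fun γ hγ => by
    have := hb γ hγ
    simp only [hU]; positivity
  have hup : ∀ γ ∈ sparseModels N L, posteriorMass X L θ κ₁ κ₂ y γ ≤ ENNReal.ofReal (U γ) := by
    intro γ hγ
    rw [posteriorMass_eq X hθ0 hθ1 κ₁ κ₂ y hγ]
    refine (mul_le_mul_right (evidence_le (hcard γ hγ).1 (hpd γ hγ) y ha (hb γ hγ)) _).trans ?_
    rw [← ENNReal.ofReal_mul (by positivity), ← mul_assoc,
      size_penalty_eq hθ1 (hcard γ hγ).1 (hcard γ hγ).2]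
  have hbs := hb γs hγs
  set Bs := κ₂ + rss (subdesign X γs) y + T with hBs
  have hBs0 : 0 < Bs := by linarith
  set Lo : ℝ := r ^ γs.card * q * (Real.Gamma a * (2 / Bs) ^ a) / 2 with hLo
  have hLo0 : 0 < Lo := by positivity
  have hlo : ENNReal.ofReal Lo ≤ posteriorMass X L θ κ₁ κ₂ y γs := by
    rw [posteriorMass_eq X hθ0 hθ1 κ₁ κ₂ y hγs]
    refine le_trans ?_ (mul_le_mul_right hlow _)
    rw [← ENNReal.ofReal_mul (by positivity), mul_div_assoc', ← mul_assoc,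
      size_penalty_eq hθ1 (hcard γs hγs).1 (hcard γs hγs).2]
  have hfin : ∀ γ ∈ sparseModels N L, posteriorMass X L θ κ₁ κ₂ y γ ≠ ∞ := fun γ hγ =>
    ne_top_of_le_ne_top ENNReal.ofReal_ne_top (hup γ hγ)
  set Sm := ∑ γ' ∈ sparseModels N L, posteriorMass X L θ κ₁ κ₂ y γ' with hSm
  have hSfin : Sm ≠ ∞ := ENNReal.sum_ne_top.2 hfin
  have hSge : posteriorMass X L θ κ₁ κ₂ y γs ≤ Sm :=
    Finset.single_le_sum (f := fun γ' => posteriorMass X L θ κ₁ κ₂ y γ')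
      (fun _ _ => zero_le) hγs
  have hms : 0 < (posteriorMass X L θ κ₁ κ₂ y γs).toReal :=
    lt_of_lt_of_le hLo0 ((ENNReal.ofReal_le_iff_le_toReal (hfin γs hγs)).1 hlo)
  have hSpos : 0 < Sm.toReal := hms.trans_le (ENNReal.toReal_mono hSfin hSge)
  refine ⟨?_, fun γ hγ => ?_⟩
  · rw [modelPosterior, ENNReal.toReal_div]
    exact div_pos hms hSpos
  · rw [modelPosterior, modelPosterior, ENNReal.toReal_div, ENNReal.toReal_div,
      ← hSm, div_div_div_cancel_right₀ hSpos.ne']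
    have h1 : (posteriorMass X L θ κ₁ κ₂ y γ).toReal ≤ U γ :=
      ENNReal.toReal_le_of_le_ofReal (hUnn γ hγ) (hup γ hγ)
    have h2 : Lo ≤ (posteriorMass X L θ κ₁ κ₂ y γs).toReal :=
      (ENNReal.ofReal_le_iff_le_toReal (hfin γs hγs)).1 hlo
    refine (div_le_div₀ (hUnn γ hγ) h1 hLo0 h2).trans (le_of_eq ?_)
    have hbγ := hb γ hγ
    have h3 : (Bs / (κ₂ + rss (subdesign X γ) y)) ^ a
        = (2 / (κ₂ + rss (subdesign X γ) y)) ^ a / (2 / Bs) ^ a := by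
      rw [← Real.div_rpow (by positivity) (by positivity)]
      congr 1
      field_simp
    rw [h3, zpow_sub₀ hr0.ne', zpow_natCast, zpow_natCast, hLo, hU]
    have h4 : (2 / Bs) ^ a ≠ 0 := by positivity
    field_simp

end PosteriorRatio

/-! ### The high-probability event -/

section Event

variable {M l : ℕ}

theorem inv_sqrt_half_pow (n : ℕ) : 1 / √((1 / 2 : ℝ) ^ n) = √2 ^ n := by
  have h : √((1 / 2 : ℝ) ^ n) = √(1 / 2) ^ n := by
    rw [Real.sqrt_eq_iff_mul_self_eq (by positivity) (by positivity), ← mul_pow,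
      Real.mul_self_sqrt (by norm_num)]
  rw [h, Real.sqrt_div (by norm_num), Real.sqrt_one, ← one_div_pow, one_div_one_div]

/-- The energy of the noise projected on an `l`-dimensional column space. -/
theorem isoGaussian_fit_tail {Z : Matrix (Fin M) (Fin l) ℝ} (hZ : (gram Z).PosDef)
    (m : Fin M → ℝ) {σ : ℝ} (hσ : 0 < σ) (t : ℝ) :
    isoGaussian m σ {y | σ ^ 2 * ((l : ℝ) * t) ≤ sqNorm (Z *ᵥ ols Z (y - m))}
      ≤ ENNReal.ofReal ((√2 * Real.exp (-t / 4)) ^ l) := by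
  have h := isoGaussian_quadratic_tail (one_sub_half_hatMatrix_posDef hZ) m hσ ((l : ℝ) * t)
  simp only [dotProduct_hatMatrix hZ] at h
  refine h.trans (ENNReal.ofReal_le_ofReal (le_of_eq ?_))
  rw [det_one_sub_half_hatMatrix hZ, mul_pow, ← Real.exp_nat_mul, ← inv_sqrt_half_pow,
    show (l : ℝ) * (-t / 4) = -((l : ℝ) * t) / 4 by ring]
  ring

/-- The total energy of the noise. -/
theorem isoGaussian_sqNorm_tail (m : Fin M → ℝ) {σ : ℝ} (hσ : 0 < σ) :
    isoGaussian m σ {y | σ ^ 2 * (4 * (M : ℝ)) ≤ sqNorm (y - m)}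
      ≤ ENNReal.ofReal (Real.exp (-(M : ℝ) / 2)) := by
  have hB : (1 : Matrix (Fin M) (Fin M) ℝ) - (1 / 2 : ℝ) • 1 = (1 / 2 : ℝ) • 1 := by
    ext i j; simp [Matrix.sub_apply]; ring
  have hpd : ((1 : Matrix (Fin M) (Fin M) ℝ) - (1 / 2 : ℝ) • 1).PosDef := by
    rw [hB]; exact Matrix.PosDef.one.smul (by norm_num)
  have h := isoGaussian_quadratic_tail hpd m hσ (4 * (M : ℝ))
  simp only [Matrix.one_mulVec, ← sqNorm_eq_dotProduct] at h
  refine h.trans (ENNReal.ofReal_le_ofReal ?_)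
  rw [hB, Matrix.det_smul, Matrix.det_one, Fintype.card_fin, mul_one, div_eq_mul_one_div,
    inv_sqrt_half_pow]
  have h1 : √2 ≤ Real.exp (1 / 2) := by
    rw [Real.sqrt_le_left (Real.exp_pos _).le, ← Real.exp_nat_mul]
    have := Real.add_one_le_exp 1
    norm_num at this ⊢
    exact this
  calc Real.exp (-(4 * (M : ℝ)) / 4) * √2 ^ M
      ≤ Real.exp (-(4 * (M : ℝ)) / 4) * Real.exp (1 / 2) ^ M := by gcongr
    _ = Real.exp (-(M : ℝ) / 2) := by
      rw [← Real.exp_nat_mul, ← Real.exp_add]; congr 1; ring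


/-- The event on which the posterior is controlled: the noise `y - m` has projected energy at most
`T` on the column space of `Z` and total energy at most `4 σ² M`, and no sparse model fits `y`
exactly (unless `κ₂ > 0`). -/
def noiseEvent {N : ℕ} (X : Matrix (Fin M) (Fin N) ℝ) (L : ℕ) (κ₂ : ℝ)
    (Z : Matrix (Fin M) (Fin l) ℝ) (m : Fin M → ℝ) (σ T : ℝ) : Set (Fin M → ℝ) :=
  {y | sqNorm (Z *ᵥ ols Z (y - m)) ≤ T} ∩ {y | sqNorm (y - m) ≤ σ ^ 2 * (4 * (M : ℝ))} ∩
    ⋂ γ ∈ sparseModels N L, {y | 0 < κ₂ + rss (subdesign X γ) y}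

theorem measurableSet_noiseEvent {N : ℕ} (X : Matrix (Fin M) (Fin N) ℝ) (L : ℕ) (κ₂ : ℝ)
    (Z : Matrix (Fin M) (Fin l) ℝ) (m : Fin M → ℝ) (σ T : ℝ) :
    MeasurableSet (noiseEvent X L κ₂ Z m σ T) := by
  have hcontfit : Continuous fun y => sqNorm (Z *ᵥ ols Z (y - m)) :=
    continuous_sqNorm.comp ((continuous_fit Z).comp (continuous_id.sub continuous_const))
  have hcontnorm : Continuous fun y => sqNorm (y - m) :=
    continuous_sqNorm.comp (continuous_id.sub continuous_const)
  refine ((isClosed_le hcontfit continuous_const).measurableSet.inter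
    (isClosed_le hcontnorm continuous_const).measurableSet).inter ?_
  exact Finset.measurableSet_biInter _ fun γ _ =>
    (isOpen_lt continuous_const (continuous_const.add (continuous_rss _))).measurableSet

/-- The projected noise is distributed as `σ²` times a chi-squared variable with `l` degrees of
freedom, so exceeding `σ² l log N` has probability at most `(√2 N^{-1/4})ˡ`; the total energy exceeds
`4 σ² M` with probability at most `e^{-M/2}`, and the third condition fails on a null set. -/
theorem one_sub_le_isoGaussian_noiseEvent {N : ℕ} (X : Matrix (Fin M) (Fin N) ℝ) {L : ℕ}
    (hLM : L < M) {κ₂ : ℝ} (hκ₂ : 0 ≤ κ₂) {Z : Matrix (Fin M) (Fin l) ℝ} (hl : 1 ≤ l)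
    (hZ : (gram Z).PosDef) (hN : 0 < N) (hNM : Real.log N ≤ 2 * M) (m : Fin M → ℝ) {σ : ℝ}
    (hσ : 0 < σ) :
    1 - 3 * (N : ℝ) ^ (-(1 / 4) : ℝ) ≤
      (isoGaussian m σ).real (noiseEvent X L κ₂ Z m σ (σ ^ 2 * l * Real.log N)) := by
  have hmeas := measurableSet_noiseEvent X L κ₂ Z m σ (σ ^ 2 * l * Real.log N)
  have hN0 : (0 : ℝ) < N := by exact_mod_cast hN
  have hpexp : (N : ℝ) ^ (-(1 / 4) : ℝ) = Real.exp (-Real.log N / 4) := by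
    rw [Real.rpow_def_of_pos hN0]; congr 1; ring
  rw [hpexp]
  set p := Real.exp (-Real.log N / 4) with hp
  have hp0 : 0 < p := Real.exp_pos _
  have hs2 : √2 ≤ 2 := by rw [Real.sqrt_le_left (by norm_num)]; norm_num
  rcases le_or_gt 1 (√2 * p) with hbig | hsmall
  · -- for small `N` the claimed lower bound is not positive
    have : 1 - 3 * p ≤ 0 := by nlinarith
    exact this.trans measureReal_nonneg
  have h1 : isoGaussian m σ {y | sqNorm (Z *ᵥ ols Z (y - m)) ≤ σ ^ 2 * l * Real.log N}ᶜ
      ≤ ENNReal.ofReal (√2 * p) := by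
    refine le_trans (measure_mono fun y hy => ?_)
      ((isoGaussian_fit_tail hZ m hσ (Real.log N)).trans (ENNReal.ofReal_le_ofReal ?_))
    · have hy' : ¬ sqNorm (Z *ᵥ ols Z (y - m)) ≤ σ ^ 2 * l * Real.log N := hy
      change σ ^ 2 * (l * Real.log N) ≤ sqNorm (Z *ᵥ ols Z (y - m))
      rw [← mul_assoc]
      exact (not_le.1 hy').le
    · exact pow_le_of_le_one (by positivity) hsmall.le (by omega)
  have h2 : isoGaussian m σ {y | sqNorm (y - m) ≤ σ ^ 2 * (4 * (M : ℝ))}ᶜ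
      ≤ ENNReal.ofReal p := by
    refine le_trans (measure_mono fun y hy => ?_)
      ((isoGaussian_sqNorm_tail m hσ).trans (ENNReal.ofReal_le_ofReal ?_))
    · have hy' : ¬ sqNorm (y - m) ≤ σ ^ 2 * (4 * (M : ℝ)) := hy
      exact (not_le.1 hy').le
    · rw [hp, Real.exp_le_exp]
      linarith
  have h3 : isoGaussian m σ
      (⋂ γ ∈ sparseModels N L, {y | 0 < κ₂ + rss (subdesign X γ) y})ᶜ = 0 := by
    rw [compl_iInter₂]
    refine (measure_biUnion_null_iff (Finset.countable_toSet _)).2 fun γ hγ => ?_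
    have hγ' : γ ∈ sparseModels N L := hγ
    refine measure_mono_null (fun y hy => ?_) (isoGaussian_rss_eq_zero
      (((Finset.mem_filter.1 hγ').2.2).trans_lt hLM) (subdesign X γ) m hσ)
    have hy' : ¬ 0 < κ₂ + rss (subdesign X γ) y := hy
    have := rss_nonneg (subdesign X γ) y
    change rss (subdesign X γ) y = 0
    linarith
  have hcompl : isoGaussian m σ (noiseEvent X L κ₂ Z m σ (σ ^ 2 * l * Real.log N))ᶜ
      ≤ ENNReal.ofReal (3 * p) := by
    rw [noiseEvent, compl_inter, compl_inter]
    refine (measure_union_le _ _).trans ?_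
    rw [h3, add_zero]
    refine (measure_union_le _ _).trans ((add_le_add h1 h2).trans ?_)
    rw [← ENNReal.ofReal_add (by positivity) hp0.le]
    exact ENNReal.ofReal_le_ofReal (by nlinarith)
  have hreal := ENNReal.toReal_le_of_le_ofReal (by positivity : 0 ≤ 3 * p) hcompl
  have := probReal_compl_eq_one_sub (μ := isoGaussian m σ) hmeas
  rw [measureReal_def] at this
  linarith

end Event

/-! ### Comparing the signal strength with the noise -/

section SignalStrength

/-- With `s = L log N`, the minimal weight exceeds the sum of the posterior spread `5 σ √s` and the
estimation error `√T`, measured in the norm of the fitted values. -/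
theorem spread_add_error_le {M lam cμ σ s T : ℝ} (hM : 0 < M) (hlam0 : 0 < lam) (hlam1 : lam ≤ 1)
    (hcμ : 6 ≤ cμ) (hσ : 0 < σ) (hs : 0 < s) (hT : T ≤ σ ^ 2 * s) :
    5 * σ * √s + √T ≤ √(M * lam) * (cμ * σ * √s / (lam * √M)) := by
  have hss : 0 < √s := Real.sqrt_pos.2 hs
  have hsT : √T ≤ σ * √s := by
    rw [Real.sqrt_le_left (by positivity), mul_pow, Real.sq_sqrt hs.le]
    exact hT
  have hlamsq : lam ≤ √lam := by
    exact Real.le_sqrt_of_sq_le (by nlinarith)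
  have hsl : 0 < √lam := Real.sqrt_pos.2 hlam0
  have hsM : 0 < √M := Real.sqrt_pos.2 hM
  have heq : √(M * lam) * (cμ * σ * √s / (lam * √M)) = (√lam / lam) * (cμ * (σ * √s)) := by
    rw [Real.sqrt_mul hM.le]; field_simp
  have hone : 1 ≤ √lam / lam := by rwa [one_le_div hlam0]
  have h6 : 6 * (σ * √s) ≤ cμ * (σ * √s) := by gcongr
  have h7 : cμ * (σ * √s) ≤ (√lam / lam) * (cμ * (σ * √s)) :=
    le_mul_of_one_le_left (by positivity) hone
  rw [heq]
  linarith

/-- The radius `5 σ √s` is large compared with the posterior spread. The constant `8.3` suffices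
since `2.1 · 4.5 · M ≤ 25 (M / 2 - 1)` for such `M`. -/
theorem spread_condition {M ℓ σ s κ₁ B : ℝ} (hM : 8.3 ≤ M) (hℓ : 0 ≤ ℓ) (hℓs : ℓ ≤ s)
    (hκ₁ : 0 < κ₁) (hB : B ≤ σ ^ 2 * (4.5 * M)) :
    2.1 * ℓ * B ≤ (5 * σ * √s) ^ 2 * ((κ₁ + M) / 2 - 1) := by
  have hs0 : 0 ≤ s := hℓ.trans hℓs
  have h1 : ℓ * (9.45 * M) ≤ s * (9.45 * M) := by gcongr
  have h2 : s * (9.45 * M) ≤ s * (25 * (M / 2 - 1)) :=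
    mul_le_mul_of_nonneg_left (by linarith) hs0
  have e2 : σ ^ 2 * (2.1 * ℓ * (4.5 * M)) ≤ σ ^ 2 * (25 * s * (M / 2 - 1)) :=
    mul_le_mul_of_nonneg_left (by linarith) (sq_nonneg σ)
  have e3 : (5 * σ * √s) ^ 2 = σ ^ 2 * (25 * s) := by
    rw [mul_pow, mul_pow, Real.sq_sqrt hs0]; ring
  calc 2.1 * ℓ * B ≤ 2.1 * ℓ * (σ ^ 2 * (4.5 * M)) := by gcongr
    _ = σ ^ 2 * (2.1 * ℓ * (4.5 * M)) := by ring
    _ ≤ σ ^ 2 * (25 * s * (M / 2 - 1)) := e2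
    _ = σ ^ 2 * (25 * s) * (M / 2 - 1) := by ring
    _ ≤ (5 * σ * √s) ^ 2 * ((κ₁ + M) / 2 - 1) := by
      rw [e3]
      exact mul_le_mul_of_nonneg_left (by linarith) (by positivity)

end SignalStrength

theorem theorem1 :
    ∃ c₁ c₂ : ℝ, 0 < c₁ ∧ 0 < c₂ ∧
    ∀ (cM cμ cθ : ℝ), 4 ≤ cM → 6 ≤ cμ → 0 < cθ →
    ∀ (M N L : ℕ) (X : Matrix (Fin M) (Fin N) ℝ) (lam θ κ₁ κ₂ σ : ℝ)
      (γs : Finset (Fin N)) (μs : Fin N → ℝ),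
      -- design matrix: columns of squared norm `M`, sparse Gram matrices well conditioned
      (∀ j, sqNorm (fun i => X i j) = M) →
      0 < lam → lam ≤ 1 →
      (∀ γ ∈ sparseModels N L, ∀ i,
        (M : ℝ) * lam ≤ (gram_isHermitian (subdesign X γ)).eigenvalues i) →
      -- prior inclusion odds
      0 < θ → θ < 1 → θ / (1 - θ) = (N : ℝ) ^ (-(cθ * (L : ℝ))) →
      -- hyperparameters of the precision prior
      0 < κ₁ → κ₁ ≤ M → 0 ≤ κ₂ → κ₂ ≤ σ ^ 2 * (M : ℝ) / 2 →
      -- true model and true weights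
      0 < σ →
      (γs.card : ℝ) ≤ min (L : ℝ) √((L : ℝ) * Real.log N) →
      subvec μs γs ∈ stdSimplex ℝ (Fin γs.card) →
      (∀ j ∈ γs, cμ * σ * √((L : ℝ) * Real.log N) / (lam * √(M : ℝ)) ≤ |μs j|) →
      -- model size bound and sample size
      3 ≤ L → cM * (γs.card : ℝ) * (L : ℝ) * Real.log N ≤ (M : ℝ) →
      -- a high-probability event on which the posterior ratio is well defined and bounded
      ∃ E : Set (Fin M → ℝ), MeasurableSet E ∧
        1 - c₁ * (N : ℝ) ^ (-c₂) ≤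
          (isoGaussian (subdesign X γs *ᵥ subvec μs γs) σ).real E ∧
        ∀ y ∈ E,
          0 < modelPosterior X L θ κ₁ κ₂ y γs ∧
          ∀ γ ∈ sparseModels N L,
            0 < κ₂ + rss (subdesign X γ) y ∧
            modelPosterior X L θ κ₁ κ₂ y γ / modelPosterior X L θ κ₁ κ₂ y γs ≤
              3 * (θ * √(2 * Real.pi) / (1 - θ)) ^ ((γ.card : ℤ) - (γs.card : ℤ)) *
                ((κ₂ + rss (subdesign X γs) y + σ ^ 2 * (γs.card : ℝ) * Real.log N) /
                  (κ₂ + rss (subdesign X γ) y)) ^ ((κ₁ + (M : ℝ)) / 2) := by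
  refine ⟨3, 1 / 4, by norm_num, by norm_num, ?_⟩
  intro cM cμ cθ hcM hcμ _ M N L X lam θ κ₁ κ₂ σ γs μs _ hlam0 hlam1 heig hθ0 hθ1 _
    hκ₁ _ hκ₂ hκ₂M hσ hcard hsimp hmin hL hMbig
  have hcard1 : 1 ≤ γs.card := by
    by_contra hcon
    have hempty : IsEmpty (Fin γs.card) := by
      rw [show γs.card = 0 by omega]; infer_instance
    have hsum := hsimp.2
    rw [Finset.univ_eq_empty, Finset.sum_empty] at hsum
    exact zero_ne_one hsum
  have hℓ1 : 1 ≤ (γs.card : ℝ) := by exact_mod_cast hcard1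
  have hℓL : (γs.card : ℝ) ≤ L := hcard.trans (min_le_left _ _)
  have hcardL : γs.card ≤ L := by exact_mod_cast hℓL
  have hγs : γs ∈ sparseModels N L :=
    Finset.mem_filter.2 ⟨Finset.mem_univ _, hcard1, hcardL⟩
  have hL3 : (3 : ℝ) ≤ L := by exact_mod_cast hL
  have hℓs := hcard.trans (min_le_right _ _)
  have hs0 : 0 < (L : ℝ) * Real.log N := Real.sqrt_pos.1 (by linarith)
  have hlog0 : 0 < Real.log N := (mul_pos_iff_of_pos_left (by linarith)).1 hs0
  have hN2 : 2 ≤ N := by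
    by_contra hcon
    have : N = 0 ∨ N = 1 := by omega
    rcases this with h | h <;> simp [h] at hlog0
  have hlog2 : 0.6931 ≤ Real.log N := by
    have h1 := Real.log_two_gt_d9
    have h2 : Real.log 2 ≤ Real.log N :=
      Real.log_le_log (by norm_num) (by exact_mod_cast hN2)
    linarith
  have hℓsq : (γs.card : ℝ) ≤ L * Real.log N := by
    have h1 := Real.mul_self_sqrt hs0.le
    nlinarith
  have hMs : 4 * ((L : ℝ) * Real.log N) ≤ M := by
    refine le_trans ?_ hMbig
    have h1 : 4 ≤ cM * (γs.card : ℝ) := by nlinarith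
    rw [mul_assoc (cM * (γs.card : ℝ))]
    exact mul_le_mul_of_nonneg_right h1 hs0.le
  have hsL : 0.6931 * (L : ℝ) ≤ L * Real.log N := by rw [mul_comm]; gcongr
  have hM8 : 8.3 ≤ (M : ℝ) := by linarith
  have hLM : L < M := by
    have : (L : ℝ) < M := by linarith
    exact_mod_cast this
  have hNM : Real.log N ≤ 2 * M := by nlinarith
  have hM0 : (0 : ℝ) < M := by linarith
  have hc0 : 0 < (M : ℝ) * lam := by positivity
  have hZc : ∀ γ ∈ sparseModels N L, ∀ u,
      (M : ℝ) * lam * sqNorm u ≤ sqNorm (subdesign X γ *ᵥ u) :=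
    fun γ hγ => mul_sqNorm_le_of_le_eigenvalues _ (heig γ hγ)
  have hpd : ∀ γ ∈ sparseModels N L, (gram (subdesign X γ)).PosDef :=
    fun γ hγ => gram_posDef_of_le hc0 (hZc γ hγ)
  have hT0 : 0 ≤ σ ^ 2 * (γs.card : ℝ) * Real.log N := by positivity
  refine ⟨noiseEvent X L κ₂ (subdesign X γs) (subdesign X γs *ᵥ subvec μs γs) σ
    (σ ^ 2 * (γs.card : ℝ) * Real.log N), measurableSet_noiseEvent _ _ _ _ _ _ _,
    one_sub_le_isoGaussian_noiseEvent X hLM hκ₂ hcard1 (hpd γs hγs) (by omega) hNM _ hσ, ?_⟩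
  rintro y ⟨⟨hy1, hy2⟩, hy3⟩
  have hb : ∀ γ ∈ sparseModels N L, 0 < κ₂ + rss (subdesign X γ) y := fun γ hγ =>
    mem_iInter₂.1 hy3 γ hγ
  have hy2' : sqNorm (y - subdesign X γs *ᵥ subvec μs γs) ≤ σ ^ 2 * (4 * (M : ℝ)) := hy2
  have hρ : ∀ i, cμ * σ * √((L : ℝ) * Real.log N) / (lam * √(M : ℝ)) ≤ subvec μs γs i :=
    fun i => by
      have h1 := hmin _ (γs.orderEmbOfFin_mem rfl i)
      rwa [abs_of_nonneg (show 0 ≤ μs (γs.orderEmbOfFin rfl i) from hsimp.1 i)] at h1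
  have hTs : σ ^ 2 * (γs.card : ℝ) * Real.log N ≤ σ ^ 2 * ((L : ℝ) * Real.log N) := by
    rw [mul_assoc]; gcongr
  have hRT := spread_add_error_le hM0 hlam0 hlam1 hcμ hσ hs0 hTs
  have hδ := spread_condition (σ := σ) (B := κ₂ + sqNorm (y - subdesign X γs *ᵥ subvec μs γs))
    hM8 (by linarith) hℓsq hκ₁ (by linarith)
  have hR : 0 < 5 * σ * √((L : ℝ) * Real.log N) := by
    have := Real.sqrt_pos.2 hs0
    positivity
  have hlow := le_evidence hcard1 hc0 (hZc γs hγs) y (κ₁ := κ₁) (κ₂ := κ₂) hsimp.2 hρ hy1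
    hR hRT (by linarith) (hb γs hγs) hδ
  obtain ⟨hpos, hratio⟩ := modelPosterior_ratio_le hθ0 hθ1 hγs hpd (by linarith) hb hT0 hlow
  refine ⟨hpos, fun γ hγ => ⟨hb γ hγ, (hratio γ hγ).trans ?_⟩⟩
  have hbγ := hb γ hγ
  have hbs := hb γs hγs
  have hθ' : 0 < 1 - θ := by linarith
  have hr : 0 ≤ (θ * √(2 * Real.pi) / (1 - θ)) ^ ((γ.card : ℤ) - (γs.card : ℤ)) := by positivity
  have hB : 0 ≤ ((κ₂ + rss (subdesign X γs) y + σ ^ 2 * (γs.card : ℝ) * Real.log N) /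
      (κ₂ + rss (subdesign X γ) y)) ^ ((κ₁ + (M : ℝ)) / 2) := by positivity
  refine mul_le_mul_of_nonneg_right ?_ hB
  exact mul_le_mul_of_nonneg_right (by norm_num) hr
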